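/- Let $\Gamma$ be a non-amenable group with a finite generating set $S$, and let $(\Gamma_n)_{n\in\mathbb N}$ be a residual chain in $\Gamma$, i.e. a decreasing sequence of finite-index normal subgroups with $\bigcap_n\Gamma_n=\{1\}$. Put $G_n=\Gamma/\Gamma_n$, with the right-invariant word metric $d_{G_n}(g,g')=\min\{|\gamma| : \gamma\in\Gamma,\ \gamma g=g'\}$, where $|\cdot|$ is the word length with respect to $S$. Let $\widehat\Gamma((\Gamma_n))=\{(g_n)\in\prod_n G_n : g_{n+1}\mapsto g_n \text{ for all } n\}$ be the completion, on which $\Gamma$ acts by left multiplication, with the metric $$d((g_n),(g'_n))=\max\{a_n : g_n\neq g'_n\}\quad(\text{and } 0 \text{ if } (g_n)=(g'_n)),$$ where $(a_n)$ is a sequence of positive reals tending to $0$ with $a_{n+1}\cdot\operatorname{diam}G_n<a_n$ for all $n$, such that $d$ has diameter at most $2$. Let $\mathcal O_\Gamma\widehat\Gamma((\Gamma_n))$ be the warped cone: the set $[1,\infty)\times\widehat\Gamma((\Gamma_n))$ with the greatest metric $d_\Gamma$ satisfying $$d_\Gamma((t,y),(t',y'))\le|t-t'|+\min(t,t')\,d(y,y')\quad\text{and}\quad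 d_\Gamma((t,y),(t,sy))\le1\ \text{ for } s\in S.$$ Suppose that the box space $\bigsqcup_nG_n$ embeds coarsely into a Hilbert space. Here $\bigsqcup_n G_n$ is the disjoint union with any metric that restricts to $d_{G_n}$ on every $G_n$ and for which, for each $R<\infty$, only finitely many pairs $(G_n,G_m)$ with $n\ne m$ are at distance at most $R$. A coarse embedding of $(X,d_X)$ into a Hilbert space $\mathcal H$ is a map $f:X\to\mathcal H$ with $\rho_-(d_X(x,x'))\le\|f(x)-f(x')\|\le\rho_+(d_X(x,x'))$ for all $x,x'\in X$, for some non-decreasing functions $\rho_\pm:[0,\infty)\to\mathbb R$ tending to infinity. Then $\mathcal O_\Gamma\widehat\Gamma((\Gamma_n))$ embeds coarsely into a Hilbert space but does not have property A. (A metric space $X$ has property A if for all $\varepsilon>0$ and $R<\infty$ there are $r<\infty$ and non-empty finite sets $A_x\subseteq X\times\mathbb N$, $x\in X$, with $A_x\subseteq B(x,r)\times\mathbb N$ and $|A_x\triangle A_y|<\varepsilon\,|A_x\cap A_y|$ whenever $d(x,y)<R$.) -/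

import Mathlib

open Filter Topology

universe u v

/-! ### Metrics, coarse embeddings and property A

A metric space is given here by a type `X` together with a distance function `d : X → X → ℝ`. -/

/-- `d` is a metric on `X` (non-negativity follows from the axioms, see `IsMetric.nonneg`). -/
structure IsMetric {X : Type u} (d : X → X → ℝ) : Prop where
  self : ∀ x, d x x = 0
  symm : ∀ x y, d x y = d y x
  triangle : ∀ x y z, d x z ≤ d x y + d y z
  eq_of_zero : ∀ x y, d x y = 0 → x = y

theorem IsMetric.nonneg {X : Type u} {d : X → X → ℝ} (h : IsMetric d) (x y : X) : 0 ≤ d x y := by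
  have h1 := h.triangle x y x
  rw [h.self, h.symm y x] at h1
  linarith

/-- `f` is a coarse embedding of `(X, d)` into the normed space `H`: there are non-decreasing
control functions `ρ₁`, `ρ₂` on `[0, ∞)`, tending to infinity, with
`ρ₁ (d x y) ≤ ‖f x - f y‖ ≤ ρ₂ (d x y)`. -/
def IsCoarseEmbedding {X : Type u} (d : X → X → ℝ) {H : Type v} [NormedAddCommGroup H]
    (f : X → H) : Prop :=
  ∃ ρ₁ ρ₂ : ℝ → ℝ,
    MonotoneOn ρ₁ (Set.Ici 0) ∧ MonotoneOn ρ₂ (Set.Ici 0) ∧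
    Tendsto ρ₁ atTop atTop ∧ Tendsto ρ₂ atTop atTop ∧
    ∀ x y, ρ₁ (d x y) ≤ ‖f x - f y‖ ∧ ‖f x - f y‖ ≤ ρ₂ (d x y)

/-- `(X, d)` embeds coarsely into some real Hilbert space. -/
def EmbedsCoarselyIntoHilbert {X : Type u} (d : X → X → ℝ) : Prop :=
  ∃ (H : Type u) (_ : NormedAddCommGroup H) (_ : InnerProductSpace ℝ H) (_ : CompleteSpace H)
    (f : X → H), IsCoarseEmbedding d f

/-- Yu's property A. The inequality `|A x ∆ A y| / |A x ∩ A y| < ε` is written without the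
quotient, so that `A x ∩ A y` is forced to be non-empty. -/
def HasPropertyA {X : Type u} (d : X → X → ℝ) : Prop :=
  ∀ ε : ℝ, 0 < ε → ∀ R : ℝ, ∃ A : X → Set (X × ℕ),
    (∀ x, (A x).Finite ∧ (A x).Nonempty) ∧
    (∀ x y, d x y < R →
      ((symmDiff (A x) (A y)).ncard : ℝ) < ε * ((A x ∩ A y).ncard : ℝ)) ∧
    ∃ r : ℝ, ∀ x, ∀ p ∈ A x, d x p.1 ≤ r

/-- `D` is a metric on the disjoint union of the metric spaces `(X n, d n)` making it a coarse
disjoint sum (box space): it restricts to `d n` on `X n`, and for every `R` only finitely many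
pairs of distinct pieces contain points at distance at most `R` from each other. -/
structure IsCoarseDisjointSum {X : ℕ → Type u} (d : ∀ n, X n → X n → ℝ)
    (D : (Σ n, X n) → (Σ n, X n) → ℝ) : Prop where
  isMetric : IsMetric D
  restrict : ∀ n (x y : X n), D ⟨n, x⟩ ⟨n, y⟩ = d n x y
  separated : ∀ R : ℝ,
    {p : ℕ × ℕ | p.1 ≠ p.2 ∧ ∃ (x : X p.1) (y : X p.2), D ⟨p.1, x⟩ ⟨p.2, y⟩ ≤ R}.Finite

/-! ### Warped metrics and cones -/

/-- `p` is a metric with `p ≤ d` and `p x (s x) ≤ 1` for every generator `s ∈ S`. -/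
structure IsWarpedBound {Γ : Type v} [Group Γ] {X : Type u} [MulAction Γ X] (S : Set Γ)
    (d p : X → X → ℝ) : Prop where
  isMetric : IsMetric p
  le_dist : ∀ x y, p x y ≤ d x y
  smul_le_one : ∀ s ∈ S, ∀ x, p x (s • x) ≤ 1

/-- The warped metric: the greatest metric `p` with `p ≤ d` and `p x (s x) ≤ 1` for `s ∈ S`. -/
noncomputable def warpedDist {Γ : Type v} [Group Γ] {X : Type u} [MulAction Γ X] (S : Set Γ)
    (d : X → X → ℝ) (x y : X) : ℝ :=
  sSup {r : ℝ | ∃ p : X → X → ℝ, IsWarpedBound S d p ∧ r = p x y}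

/-- `warpedDist` is the greatest metric with the required properties, as soon as there is one. -/
theorem warpedDist_isGreatest {Γ : Type v} [Group Γ] {X : Type u} [MulAction Γ X] (S : Set Γ)
    (d : X → X → ℝ) (h : ∃ p, IsWarpedBound S d p) :
    IsGreatest {p | IsWarpedBound S d p} (warpedDist S d) := by
  obtain ⟨p₀, h₀⟩ := h
  have hle : ∀ p, IsWarpedBound S d p → ∀ x y, p x y ≤ warpedDist S d x y := fun p hp x y =>
    le_csSup ⟨d x y, by rintro _ ⟨q, hq, rfl⟩; exact hq.le_dist x y⟩ ⟨p, hp, rfl⟩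
  have hsup : ∀ x y c, (∀ p, IsWarpedBound S d p → p x y ≤ c) → warpedDist S d x y ≤ c :=
    fun x y c hc => csSup_le ⟨_, p₀, h₀, rfl⟩ (by rintro _ ⟨q, hq, rfl⟩; exact hc q hq)
  refine ⟨⟨⟨fun x => ?_, fun x y => ?_, fun x y z => ?_, fun x y hxy => ?_⟩,
    fun x y => hsup x y _ fun p hp => hp.le_dist x y,
    fun s hs x => hsup _ _ _ fun p hp => hp.smul_le_one s hs x⟩, fun p hp x y => hle p hp x y⟩
  · refine le_antisymm (hsup _ _ _ fun p hp => (hp.isMetric.self x).le) ?_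
    rw [← h₀.isMetric.self x]
    exact hle p₀ h₀ x x
  · refine le_antisymm (hsup _ _ _ fun p hp => ?_) (hsup _ _ _ fun p hp => ?_)
    · rw [hp.isMetric.symm]; exact hle p hp y x
    · rw [hp.isMetric.symm]; exact hle p hp x y
  · exact hsup _ _ _ fun p hp =>
      (hp.isMetric.triangle x y z).trans (add_le_add (hle p hp x y) (hle p hp y z))
  · exact h₀.isMetric.eq_of_zero x y
      (le_antisymm ((hle p₀ h₀ x y).trans hxy.le) (h₀.isMetric.nonneg x y))

/-- The underlying set `[1, ∞) × Y` of the cone of `Y`. -/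
@[ext]
structure MetricCone (Y : Type u) where
  radius : ℝ
  one_le : 1 ≤ radius
  point : Y

/-- The cone metric `|t - t'| + min (t, t') * d (y, y')` (for `d` a metric of diameter at
most `2`). -/
noncomputable def coneDist {Y : Type u} (d : Y → Y → ℝ) (x y : MetricCone Y) : ℝ :=
  |x.radius - y.radius| + min x.radius y.radius * d x.point y.point

/-- The action `γ (t, y) = (t, γ y)` on the cone. -/
instance {Γ : Type v} [Group Γ] {Y : Type u} [MulAction Γ Y] : MulAction Γ (MetricCone Y) where
  smul γ x := ⟨x.radius, x.one_le, γ • x.point⟩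
  one_smul x := by
    cases x
    exact congrArg (MetricCone.mk _ _) (one_smul Γ _)
  mul_smul γ γ' x := by
    cases x
    exact congrArg (MetricCone.mk _ _) (mul_smul γ γ' _)

/-- The metric of the warped cone of `(Y, d)` with respect to the generating set `S` of `Γ`. -/
noncomputable def warpedConeDist {Γ : Type v} [Group Γ] {Y : Type u} [MulAction Γ Y] (S : Set Γ)
    (d : Y → Y → ℝ) : MetricCone Y → MetricCone Y → ℝ :=
  warpedDist S (coneDist d)

/-- On a warped cone the greatest metric with the required properties exists. -/
theorem warpedConeDist_isGreatest {Γ : Type v} [Group Γ] {Y : Type u} [MulAction Γ Y] (S : Set Γ)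
    {d : Y → Y → ℝ} (hd : IsMetric d) :
    IsGreatest {p | IsWarpedBound S (coneDist d) p} (warpedConeDist S d) := by
  refine warpedDist_isGreatest S _
    ⟨fun x y => |x.radius - y.radius| + min 1 (d x.point y.point), ⟨⟨?_, ?_, ?_, ?_⟩, ?_, ?_⟩⟩
  · intro x
    simp [hd.self]
  · intro x y
    simp only [hd.symm x.point, abs_sub_comm x.radius]
  · intro x y z
    have h1 := abs_sub_le x.radius y.radius z.radius
    have h2 := hd.triangle x.point y.point z.point
    have h3 := hd.nonneg x.point y.point
    have h4 := hd.nonneg y.point z.point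
    have h5 : min 1 (d x.point z.point) ≤ min 1 (d x.point y.point) + min 1 (d y.point z.point) := by
      simp only [min_def]
      split_ifs <;> linarith
    linarith
  · intro x y h
    have h1 := abs_nonneg (x.radius - y.radius)
    have h2 : 0 ≤ min 1 (d x.point y.point) := le_min zero_le_one (hd.nonneg _ _)
    have h3 : |x.radius - y.radius| = 0 := by linarith
    have h4 : min 1 (d x.point y.point) = 0 := by linarith
    have h5 : d x.point y.point = 0 := by
      simp only [min_def] at h4
      split_ifs at h4
      · linarith
      · exact h4
    exact MetricCone.ext (sub_eq_zero.1 (abs_eq_zero.1 h3)) (hd.eq_of_zero _ _ h5)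
  · intro x y
    have h1 : min 1 (d x.point y.point) ≤ min x.radius y.radius * d x.point y.point :=
      (min_le_right _ _).trans
        (le_mul_of_one_le_left (hd.nonneg _ _) (le_min x.one_le y.one_le))
    exact add_le_add le_rfl h1
  · intro s _ x
    change |x.radius - x.radius| + min 1 (d x.point (s • x.point)) ≤ 1
    simp

/-! ### Groups: amenability, word lengths, completions -/

/-- Amenability of a discrete group: there is a finitely additive left-invariant probability
measure defined on all subsets. -/
def IsAmenableGroup (Γ : Type u) [Group Γ] : Prop :=
  ∃ μ : Set Γ → ℝ, (∀ A, 0 ≤ μ A) ∧ μ Set.univ = 1 ∧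
    (∀ A B, Disjoint A B → μ (A ∪ B) = μ A + μ B) ∧
    ∀ (γ : Γ) (A : Set Γ), μ ((fun x => γ * x) '' A) = μ A

/-- The word length of `γ` with respect to the generating set `S`. -/
noncomputable def groupWordLength {Γ : Type u} [Group Γ] (S : Set Γ) (γ : Γ) : ℕ :=
  sInf {k : ℕ | ∃ l : List Γ, (∀ s ∈ l, s ∈ S ∨ s⁻¹ ∈ S) ∧ l.prod = γ ∧ l.length = k}

/-- The right-invariant word metric on `Γ ⧸ N`: the distance of `g` and `g'` is the length of the
shortest `γ ∈ Γ` with `γ g = g'`. -/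
noncomputable def quotientWordDist {Γ : Type u} [Group Γ] (S : Set Γ) (N : Subgroup Γ) [N.Normal]
    (g g' : Γ ⧸ N) : ℕ :=
  sInf {k : ℕ | ∃ γ : Γ, (γ : Γ ⧸ N) * g = g' ∧ groupWordLength S γ = k}

/-- The diameter of `Γ ⧸ N` in the right-invariant word metric (for `N` of finite index). -/
noncomputable def quotientWordDiam {Γ : Type u} [Group Γ] (S : Set Γ) (N : Subgroup Γ)
    [N.Normal] : ℕ :=
  sSup (Set.range fun p : (Γ ⧸ N) × (Γ ⧸ N) => quotientWordDist S N p.1 p.2)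

/-- The completion of `Γ` with respect to a decreasing sequence `N` of normal subgroups: the
inverse limit of the groups `Γ ⧸ N n`, as a subgroup of their product. -/
def completionSubgroup {Γ : Type u} [Group Γ] (N : ℕ → Subgroup Γ) [∀ n, (N n).Normal]
    (hN : Antitone N) : Subgroup (∀ n, Γ ⧸ N n) where
  carrier := {g | ∀ n,
    QuotientGroup.map (N (n + 1)) (N n) (MonoidHom.id Γ) (hN n.le_succ) (g (n + 1)) = g n}
  one_mem' n := by simp
  mul_mem' ha hb n := by simp only [Pi.mul_apply, map_mul, ha n, hb n]
  inv_mem' ha n := by simp only [Pi.inv_apply, map_inv, ha n]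

/-- The completion of `Γ` with respect to a decreasing sequence `N` of normal subgroups. -/
def GroupCompletion {Γ : Type u} [Group Γ] (N : ℕ → Subgroup Γ) [∀ n, (N n).Normal]
    (hN : Antitone N) : Type u :=
  completionSubgroup N hN

/-- `Γ` acts on its completion by left multiplication, through the quotient maps. -/
instance {Γ : Type u} [Group Γ] (N : ℕ → Subgroup Γ) [∀ n, (N n).Normal] (hN : Antitone N) :
    MulAction Γ (GroupCompletion N hN) where
  smul γ g := ⟨fun n => (γ : Γ ⧸ N n) * g.1 n, fun n => by
    rw [map_mul, g.2 n]; rfl⟩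
  one_smul g := Subtype.ext (funext fun n => one_mul (g.1 n))
  mul_smul γ γ' g := Subtype.ext (funext fun n => mul_assoc (γ : Γ ⧸ N n) (γ' : Γ ⧸ N n) (g.1 n))

open Classical in
/-- The metric `max_n a n * d_bin (g n) (g' n)` on the completion, where `d_bin` is the discrete
`{0, 1}`-valued metric. -/
noncomputable def completionDist {Γ : Type u} [Group Γ] {N : ℕ → Subgroup Γ} [∀ n, (N n).Normal]
    {hN : Antitone N} (a : ℕ → ℝ) (g g' : GroupCompletion N hN) : ℝ :=
  ⨆ n, a n * (if g.1 n = g'.1 n then 0 else 1)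

/-- `completionDist` is a metric, for positive coefficients tending to zero. -/
theorem completionDist_isMetric {Γ : Type u} [Group Γ] {N : ℕ → Subgroup Γ} [∀ n, (N n).Normal]
    {hN : Antitone N} {a : ℕ → ℝ} (ha_pos : ∀ n, 0 < a n) (ha_lim : Tendsto a atTop (𝓝 0)) :
    IsMetric (completionDist a : GroupCompletion N hN → GroupCompletion N hN → ℝ) := by
  classical
  obtain ⟨C, hC⟩ := ha_lim.bddAbove_range
  have hbdd : ∀ g g' : GroupCompletion N hN,
      BddAbove (Set.range fun n => a n * (if g.1 n = g'.1 n then (0 : ℝ) else 1)) := by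
    refine fun g g' => ⟨C, ?_⟩
    rintro _ ⟨n, rfl⟩
    have h1 := ha_pos n
    have h2 : a n ≤ C := hC ⟨n, rfl⟩
    dsimp only
    split_ifs <;> linarith
  have hle : ∀ (g g' : GroupCompletion N hN) (n : ℕ),
      a n * (if g.1 n = g'.1 n then (0 : ℝ) else 1) ≤ completionDist a g g' := by
    intro g g' n
    have := le_ciSup (hbdd g g') n
    unfold completionDist
    convert this
  refine ⟨fun g => by simp [completionDist], fun g g' => ?_, fun g g' g'' => ?_, fun g g' h => ?_⟩
  · simp only [completionDist, eq_comm]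
  · refine ciSup_le fun n => ?_
    have h1 := hle g g' n
    have h2 := hle g' g'' n
    have h3 := ha_pos n
    refine le_trans ?_ (add_le_add h1 h2)
    clear h1 h2
    by_cases e1 : g.1 n = g'.1 n
    · rw [e1, if_pos rfl]
      linarith
    · rw [if_neg e1]
      split_ifs <;> linarith
  · refine Subtype.ext (funext fun n => ?_)
    by_contra hne
    have h1 := hle g g' n
    rw [h, if_neg hne, mul_one] at h1
    exact absurd (ha_pos n) (not_lt.2 h1)

/-! Embedding. At radius `t`, two points of the completion that agree at level `n` are about `t * a
(n + 1)` apart at most, so between the scales `t * a (n + 1)` and `t * a n` the cone looks like `Γ ⧸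
N n` with its word metric. The box space supplies maps of all these quotients into one Hilbert space
with common control functions. Dividing the map of level `j` by `k + 1` and composing with a bounded
Gaussian map gives `P j k`, which detects distances beyond scale `k + 1`. The embedding collects all
`P j k` in an `ℓ²` sum, weighted by a continuous cut-off of the condition that scale `k + 1` lies
between those of levels `j + 1` and `j`, and adjoins the radius. It is Lipschitz
(`exists_lipschitz_weighted_sum`): boundedness of `P` controls the radius and the fibre, and
convergence of `∑ 1 / (k + 1) ^ 2` controls the generators. It is proper
(`warpedConeDist_bounded_of_norm_weighted_sum_le`): close images leave few separating scales, and
the diameter condition on `a` covers the case where two consecutive levels offer few scales.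

No property A (`isAmenableGroup_of_hasPropertyA`). At a large radius, each point of a set `A x` is
reached from `x`, as seen in `Γ ⧸ N n`, by a short element of `Γ`, unique because `N n` misses a
large ball. The inverses of these elements carry the counting measure of `A x` to `Γ`. Averaging
over a deeper quotient `Γ ⧸ N m` gives almost invariant means, and an ultralimit of them is an
invariant mean. -/

/-! ### Gaussian kernels on Hilbert spaces. -/

/-- Tensor powers of vectors: `⟪P u, P v⟫ = ⟪u, v⟫ ^ n`. -/
theorem exists_tensorPower_map (H : Type u) [NormedAddCommGroup H] [InnerProductSpace ℝ H] (n : ℕ) :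
    ∃ (T : Type u) (_ : NormedAddCommGroup T) (_ : InnerProductSpace ℝ T) (P : H → T),
      ∀ x y, inner ℝ (P x) (P y) = (inner ℝ x y : ℝ) ^ n := by
  induction n with
  | zero =>
    exact ⟨EuclideanSpace ℝ PUnit.{u + 1}, inferInstance, inferInstance,
      fun _ => EuclideanSpace.single PUnit.unit 1, fun x y => by simp⟩
  | succ n ih =>
    obtain ⟨T, _, _, P, hP⟩ := ih
    refine ⟨TensorProduct ℝ T H, inferInstance, inferInstance, fun x => P x ⊗ₜ[ℝ] x, fun x y => ?_⟩
    rw [TensorProduct.inner_tmul, hP, pow_succ]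

/-- A map with Gaussian kernel `exp (-‖x - y‖² / 2)`. -/
theorem exists_gaussian_map (H : Type u) [NormedAddCommGroup H] [InnerProductSpace ℝ H] :
    ∃ (T : Type u) (_ : NormedAddCommGroup T) (_ : InnerProductSpace ℝ T) (_ : CompleteSpace T)
      (P : H → T), ∀ x y, inner ℝ (P x) (P y) = Real.exp (-(‖x - y‖ ^ 2 / 2)) := by
  choose T i1 i2 P hP using exists_tensorPower_map H
  -- With these factors the inner products add up to the exponential series of `⟪x, y⟫`, and the
  -- Gaussian prefactors complete the square.
  let c : ℕ → H → ℝ := fun n x => Real.exp (-(‖x‖ ^ 2 / 2)) / √(n.factorial)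
  have hin : ∀ n x y, inner ℝ (c n x • P n x) (c n y • P n y) =
      Real.exp (-(‖x‖ ^ 2 / 2)) * Real.exp (-(‖y‖ ^ 2 / 2)) *
        ((inner ℝ x y : ℝ) ^ n / n.factorial) := by
    intro n x y
    rw [real_inner_smul_left, real_inner_smul_right, hP]
    have h : (√(n.factorial) : ℝ) * √(n.factorial) = n.factorial :=
      Real.mul_self_sqrt (by positivity)
    calc _ = Real.exp (-(‖x‖ ^ 2 / 2)) * Real.exp (-(‖y‖ ^ 2 / 2)) *
          ((inner ℝ x y : ℝ) ^ n / (√(n.factorial) * √(n.factorial))) := by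
          simp only [c]
          field_simp
      _ = _ := by rw [h]
  have hmem : ∀ x, Memℓp (fun n => c n x • P n x) 2 := by
    intro x
    refine memℓp_gen ?_
    have h : ∀ n, ‖c n x • P n x‖ ^ (2 : ENNReal).toReal =
        Real.exp (-(‖x‖ ^ 2 / 2)) * Real.exp (-(‖x‖ ^ 2 / 2)) *
        ((inner ℝ x x : ℝ) ^ n / n.factorial) := by
      intro n
      rw [← hin n x x, real_inner_self_eq_norm_sq]
      simp
    simp only [h]
    exact (Real.summable_pow_div_factorial _).mul_left _
  let Q : H → lp T 2 := fun x => ⟨fun n => c n x • P n x, hmem x⟩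
  have hQ : ∀ x y, inner ℝ (Q x) (Q y) = Real.exp (-(‖x - y‖ ^ 2 / 2)) := by
    intro x y
    rw [lp.inner_eq_tsum]
    have h : ∀ n, inner ℝ (Q x n) (Q y n) = Real.exp (-(‖x‖ ^ 2 / 2)) * Real.exp (-(‖y‖ ^ 2 / 2)) *
        ((inner ℝ x y : ℝ) ^ n / n.factorial) := fun n => hin n x y
    simp only [h]
    have he : ∑' n : ℕ, (inner ℝ x y : ℝ) ^ n / n.factorial = Real.exp (inner ℝ x y : ℝ) := by
      rw [Real.exp_eq_exp_ℝ, NormedSpace.exp_eq_tsum_div]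
    rw [tsum_mul_left, he, ← Real.exp_add, ← Real.exp_add, norm_sub_sq_real]
    ring_nf
  -- Algebraic tensor powers need not be complete, so neither need their `ℓ²` sum.
  refine ⟨UniformSpace.Completion (lp T 2), inferInstance, inferInstance, inferInstance,
    fun x => (Q x : UniformSpace.Completion (lp T 2)), fun x y => ?_⟩
  rw [UniformSpace.Completion.inner_coe, hQ]

/-- Every Hilbert space admits a bounded Lipschitz map that keeps points at distance at least `1`
uniformly separated. -/
theorem exists_bounded_separating_map (H : Type u) [NormedAddCommGroup H] [InnerProductSpace ℝ H] :
    ∃ (T : Type u) (_ : NormedAddCommGroup T) (_ : InnerProductSpace ℝ T) (_ : CompleteSpace T)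
      (P : H → T), (∀ x, ‖P x‖ ≤ 1) ∧ (∀ x y, ‖P x - P y‖ ≤ ‖x - y‖) ∧
        ∀ x y, 1 ≤ ‖x - y‖ → 1 / 2 ≤ ‖P x - P y‖ := by
  obtain ⟨T, i1, i2, i3, P, hP⟩ := exists_gaussian_map H
  have h1 : ∀ x, ‖P x‖ ^ 2 = 1 := fun x => by
    rw [← real_inner_self_eq_norm_sq, hP]; simp
  have h2 : ∀ x y, ‖P x - P y‖ ^ 2 = 2 - 2 * Real.exp (-(‖x - y‖ ^ 2 / 2)) := fun x y => by
    rw [norm_sub_sq_real, h1, h1, hP]; ring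
  refine ⟨T, i1, i2, i3, P, fun x => ?_, fun x y => ?_, fun x y hxy => ?_⟩
  · nlinarith [h1 x, norm_nonneg (P x)]
  · refine abs_le_of_sq_le_sq' ?_ (norm_nonneg _) |>.2
    rw [h2]
    have := Real.add_one_le_exp (-(‖x - y‖ ^ 2 / 2))
    linarith
  · refine abs_le_of_sq_le_sq' ?_ (norm_nonneg _) |>.2
    rw [h2]
    have h3 : Real.exp (-(‖x - y‖ ^ 2 / 2)) ≤ Real.exp (-(1 / 2)) :=
      Real.exp_le_exp.2 (by nlinarith)
    have h4 : Real.exp (-(1 / 2 : ℝ)) ≤ 2 / 3 := by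
      -- `exp (1 / 2) ≥ 3 / 2` suffices: it gives `‖P x - P y‖ ^ 2 ≥ 2 - 4 / 3 > 1 / 4`.
      rw [Real.exp_neg]
      have := Real.add_one_le_exp (1 / 2 : ℝ)
      rw [inv_le_comm₀ (by positivity) (by positivity)]
      norm_num at this ⊢
      linarith
    norm_num
    linarith

/-! ### Square-summable families and coarse embeddings. -/

/-- A family of vectors with bounded sums of norms is square summable. -/
theorem memℓp_two_of_sum_norm_le {ι : Type*} {T : Type*} [NormedAddCommGroup T] {B : ℝ}
    {v : ι → T} (h : ∀ s : Finset ι, ∑ i ∈ s, ‖v i‖ ≤ B) : Memℓp v 2 := by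
  refine memℓp_gen' (C := B ^ 2) fun s => ?_
  simp only [ENNReal.toReal_ofNat, Real.rpow_ofNat]
  exact (Finset.sum_sq_le_sq_sum_of_nonneg fun i _ => norm_nonneg _).trans
    (pow_le_pow_left₀ (Finset.sum_nonneg fun i _ => norm_nonneg _) (h s) 2)

theorem lp_two_norm_le_of_sum_sq_le {ι : Type*} {T : Type*} [NormedAddCommGroup T]
    {B : ℝ} (hB : 0 ≤ B) {v : lp (fun _ : ι => T) 2}
    (h : ∀ s : Finset ι, ∑ i ∈ s, ‖v i‖ ^ 2 ≤ B ^ 2) : ‖v‖ ≤ B := by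
  refine lp.norm_le_of_forall_sum_le (by simp) hB fun s => ?_
  simpa using h s

theorem lp_two_norm_le_of_sum_norm_le {ι : Type*} {T : Type*} [NormedAddCommGroup T] {B : ℝ}
    {v : lp (fun _ : ι => T) 2} (h : ∀ s : Finset ι, ∑ i ∈ s, ‖v i‖ ≤ B) : ‖v‖ ≤ B :=
  lp_two_norm_le_of_sum_sq_le (by simpa using h ∅) fun s =>
    (Finset.sum_sq_le_sq_sum_of_nonneg fun i _ => norm_nonneg _).trans
      (pow_le_pow_left₀ (Finset.sum_nonneg fun i _ => norm_nonneg _) (h s) 2)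

theorem sum_le_of_forall_range_prod_le {f : ℕ × ℕ → ℝ} {B : ℝ} (hf : ∀ i, 0 ≤ f i)
    (h : ∀ J K, ∑ k ∈ Finset.range K, ∑ j ∈ Finset.range J, f (j, k) ≤ B) (s : Finset (ℕ × ℕ)) :
    ∑ i ∈ s, f i ≤ B := by
  obtain ⟨J, hJ⟩ := (s.image Prod.fst).exists_nat_subset_range
  obtain ⟨K, hK⟩ := (s.image Prod.snd).exists_nat_subset_range
  have hs : s ⊆ Finset.range J ×ˢ Finset.range K := fun i hi =>
    Finset.mem_product.2 ⟨hJ (Finset.mem_image_of_mem _ hi), hK (Finset.mem_image_of_mem _ hi)⟩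
  refine (Finset.sum_le_sum_of_subset_of_nonneg hs fun i _ _ => hf i).trans ?_
  rw [Finset.sum_product_right]
  exact h J K

/-- A Lipschitz map that is metrically proper (uniformly) is a coarse embedding. -/
theorem isCoarseEmbedding_of_lipschitz {X : Type u} {d : X → X → ℝ} (hd : ∀ x y, 0 ≤ d x y)
    {H : Type v} [NormedAddCommGroup H] {f : X → H} {C : ℝ} (hC : 0 ≤ C)
    (hlip : ∀ x y, ‖f x - f y‖ ≤ C * d x y)
    (hprop : ∀ M : ℝ, ∃ K : ℝ, ∀ x y, ‖f x - f y‖ ≤ M → d x y ≤ K) : IsCoarseEmbedding d f := by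
  -- The lower control function is the infimum of `V s`. Including `Set.Ici s` keeps `V s` non-empty
  -- when no two points are `s` apart, as happens for bounded `d`.
  let V : ℝ → Set ℝ := fun s => Set.Ici s ∪ {r | ∃ x y, s ≤ d x y ∧ r = ‖f x - f y‖}
  have hV0 : ∀ s, 0 ≤ s → ∀ r ∈ V s, 0 ≤ r := by
    rintro s hs r (hr | ⟨x, y, _, rfl⟩)
    · exact hs.trans hr
    · exact norm_nonneg _
  have hVb : ∀ s, 0 ≤ s → BddBelow (V s) := fun s hs => ⟨0, fun r hr => hV0 s hs r hr⟩
  have hVne : ∀ s, (V s).Nonempty := fun s => ⟨s, Or.inl Set.self_mem_Ici⟩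
  -- The slope `C + 1` makes the upper control function tend to infinity also when `C = 0`.
  refine ⟨fun s => sInf (V s), fun s => (C + 1) * s, ?_, ?_, ?_, ?_, fun x y => ⟨?_, ?_⟩⟩
  · intro s hs t ht hst
    refine csInf_le_csInf (hVb s hs) (hVne t) ?_
    rintro r (hr | ⟨x, y, h, rfl⟩)
    · exact Or.inl (hst.trans hr)
    · exact Or.inr ⟨x, y, hst.trans h, rfl⟩
  · intro s _ t _ hst
    exact mul_le_mul_of_nonneg_left hst (by linarith)
  · refine tendsto_atTop.2 fun M => ?_
    obtain ⟨K, hK⟩ := hprop M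
    filter_upwards [eventually_gt_atTop K, eventually_ge_atTop M] with s h1 h2
    refine le_csInf (hVne s) ?_
    rintro r (hr | ⟨x, y, h, rfl⟩)
    · exact h2.trans hr
    · by_contra hlt
      linarith [hK x y (not_le.1 hlt).le]
  · exact tendsto_id.const_mul_atTop (by linarith)
  · exact csInf_le (hVb _ (hd x y)) (Or.inr ⟨x, y, le_rfl, rfl⟩)
  · refine (hlip x y).trans (mul_le_mul_of_nonneg_right (by linarith) (hd x y))

/-! ### Lower and upper bounds for warped metrics -/

section Warped

variable {Γ : Type v} [Group Γ] {Y : Type u} [MulAction Γ Y] {S : Set Γ} {d : Y → Y → ℝ}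

theorem warpedConeDist_isWarpedBound (S : Set Γ) (hd : IsMetric d) :
    IsWarpedBound S (coneDist d) (warpedConeDist S d) :=
  (warpedConeDist_isGreatest S hd).1

/-- The warped metric dominates all pseudometrics satisfying its defining inequalities. -/
theorem le_warpedConeDist (hd : IsMetric d) {q : MetricCone Y → MetricCone Y → ℝ}
    (hself : ∀ x, q x x = 0) (hsymm : ∀ x y, q x y = q y x)
    (htri : ∀ x y z, q x z ≤ q x y + q y z) (hle : ∀ x y, q x y ≤ coneDist d x y)
    (hS : ∀ s ∈ S, ∀ x, q x (s • x) ≤ 1) (x y : MetricCone Y) : q x y ≤ warpedConeDist S d x y := by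
  have hw := warpedConeDist_isWarpedBound S hd
  -- The maximum with the warped metric turns the pseudometric `q` into a metric competing in the
  -- supremum.
  have h : IsWarpedBound S (coneDist d) fun x y => max (q x y) (warpedConeDist S d x y) := by
    refine ⟨⟨fun x => ?_, fun x y => ?_, fun x y z => ?_, fun x y h => ?_⟩, fun x y => ?_,
      fun s hs x => ?_⟩
    · rw [hself, hw.isMetric.self, max_self]
    · rw [hsymm, hw.isMetric.symm]
    · exact max_le ((htri x y z).trans (add_le_add (le_max_left _ _) (le_max_left _ _)))
        ((hw.isMetric.triangle x y z).trans (add_le_add (le_max_right _ _) (le_max_right _ _)))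
    · exact hw.isMetric.eq_of_zero x y
        (le_antisymm ((le_max_right _ _).trans h.le) (hw.isMetric.nonneg x y))
    · exact max_le (hle x y) (hw.le_dist x y)
    · exact max_le (hS s hs x) (hw.smul_le_one s hs x)
  exact (le_max_left _ _).trans ((warpedConeDist_isGreatest S hd).2 h x y)

/-- A map on the cone that is Lipschitz in the radius and in the point, and along the action of the
generators, is Lipschitz for the warped metric. -/
theorem norm_sub_le_mul_warpedConeDist (hd : IsMetric d) {H : Type*} [NormedAddCommGroup H]
    {f : MetricCone Y → H} {C : ℝ} (hC : 0 < C)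
    (hrad : ∀ x y : MetricCone Y, x.point = y.point → ‖f x - f y‖ ≤ C * |x.radius - y.radius|)
    (hpt : ∀ x y : MetricCone Y, x.radius = y.radius →
      ‖f x - f y‖ ≤ C * (x.radius * d x.point y.point))
    (hS : ∀ s ∈ S, ∀ x, ‖f x - f (s • x)‖ ≤ C) (x y : MetricCone Y) :
    ‖f x - f y‖ ≤ C * warpedConeDist S d x y := by
  have key : ∀ x y : MetricCone Y, x.radius ≤ y.radius → ‖f x - f y‖ ≤ C * coneDist d x y := by
    intro x y hxy
    -- Moving along the fibre at the smaller radius matches the `min` in `coneDist`.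
    have h1 := hpt x ⟨x.radius, x.one_le, y.point⟩ rfl
    have h2 := hrad ⟨x.radius, x.one_le, y.point⟩ y rfl
    have h3 := norm_sub_le_norm_sub_add_norm_sub (f x) (f ⟨x.radius, x.one_le, y.point⟩) (f y)
    simp only [coneDist, min_eq_left hxy]
    simp only at h1 h2
    linarith
  have key' : ∀ x y : MetricCone Y, ‖f x - f y‖ ≤ C * coneDist d x y := by
    intro x y
    rcases le_total x.radius y.radius with h | h
    · exact key x y h
    · rw [norm_sub_rev]
      refine (key y x h).trans_eq ?_
      simp only [coneDist, abs_sub_comm y.radius, min_comm y.radius, hd.symm y.point]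
  rw [← div_le_iff₀' hC]
  refine le_warpedConeDist hd (q := fun x y => ‖f x - f y‖ / C) (fun x => by simp)
    (fun x y => by rw [norm_sub_rev]) (fun x y z => ?_) (fun x y => ?_) (fun s hs x => ?_) x y
  · rw [← add_div]
    exact div_le_div_of_nonneg_right (norm_sub_le_norm_sub_add_norm_sub _ _ _) hC.le
  · rw [div_le_iff₀' hC]
    exact key' x y
  · rw [div_le_one hC]
    exact hS s hs x

theorem abs_radius_sub_le_warpedConeDist (hd : IsMetric d) (x y : MetricCone Y) :
    |x.radius - y.radius| ≤ warpedConeDist S d x y := by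
  have h := norm_sub_le_mul_warpedConeDist (S := S) hd (f := fun x => x.radius) one_pos
    (fun x y _ => by simp) (fun x y h => ?_) (fun s _ x => ?_) x y
  · simpa using h
  · simpa [h] using mul_nonneg (zero_le_one.trans y.one_le) (hd.nonneg x.point y.point)
  · change ‖x.radius - x.radius‖ ≤ 1
    simp

end Warped

/-! ### Word lengths -/

section Words

variable {Γ : Type u} [Group Γ] {S : Set Γ}

theorem exists_word_of_closure_eq_top (hS : Subgroup.closure S = ⊤) (γ : Γ) :
    ∃ l : List Γ, (∀ s ∈ l, s ∈ S ∨ s⁻¹ ∈ S) ∧ l.prod = γ := by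
  have h : γ ∈ (Subgroup.closure S).toSubmonoid := by rw [hS]; trivial
  rw [Subgroup.closure_toSubmonoid] at h
  exact Submonoid.exists_list_of_mem_closure h

theorem exists_word_length_eq (hS : Subgroup.closure S = ⊤) (γ : Γ) :
    ∃ l : List Γ, (∀ s ∈ l, s ∈ S ∨ s⁻¹ ∈ S) ∧ l.prod = γ ∧ l.length = groupWordLength S γ := by
  obtain ⟨l, h1, h2⟩ := exists_word_of_closure_eq_top hS γ
  exact Nat.sInf_mem
    (s := {k : ℕ | ∃ l : List Γ, (∀ s ∈ l, s ∈ S ∨ s⁻¹ ∈ S) ∧ l.prod = γ ∧ l.length = k})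
    ⟨l.length, l, h1, h2, rfl⟩

theorem groupWordLength_le (l : List Γ) (hl : ∀ s ∈ l, s ∈ S ∨ s⁻¹ ∈ S) :
    groupWordLength S l.prod ≤ l.length :=
  Nat.sInf_le ⟨l, hl, rfl, rfl⟩

theorem groupWordLength_le_one {s : Γ} (hs : s ∈ S) : groupWordLength S s ≤ 1 := by
  have := groupWordLength_le (S := S) [s] (by simp [hs])
  simpa using this

theorem groupWordLength_mul_le (hS : Subgroup.closure S = ⊤) (γ γ' : Γ) :
    groupWordLength S (γ * γ') ≤ groupWordLength S γ + groupWordLength S γ' := by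
  obtain ⟨l, h1, h2, h3⟩ := exists_word_length_eq hS γ
  obtain ⟨l', h1', h2', h3'⟩ := exists_word_length_eq hS γ'
  have := groupWordLength_le (S := S) (l ++ l') (by
    intro s hs
    rcases List.mem_append.1 hs with h | h
    exacts [h1 s h, h1' s h])
  rw [List.prod_append, h2, h2', List.length_append, h3, h3'] at this
  exact this

theorem groupWordLength_inv_le (hS : Subgroup.closure S = ⊤) (γ : Γ) :
    groupWordLength S γ⁻¹ ≤ groupWordLength S γ := by
  obtain ⟨l, h1, h2, h3⟩ := exists_word_length_eq hS γ
  have := groupWordLength_le (S := S) ((l.map fun x => x⁻¹).reverse) (by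
    intro s hs
    simp only [List.mem_reverse, List.mem_map] at hs
    obtain ⟨a, ha, rfl⟩ := hs
    rw [inv_inv]
    exact (h1 a ha).symm)
  rw [← List.prod_inv_reverse, h2] at this
  simpa [h3] using this

theorem finite_groupWordLength_le (hfin : S.Finite) (hS : Subgroup.closure S = ⊤) (k : ℕ) :
    {γ : Γ | groupWordLength S γ ≤ k}.Finite := by
  have hT : (S ∪ S⁻¹).Finite := hfin.union hfin.inv
  have := hT.to_subtype
  refine ((List.finite_length_le (↥(S ∪ S⁻¹)) k).image
    fun l => (l.map Subtype.val).prod).subset fun γ hγ => ?_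
  obtain ⟨l, h1, h2, h3⟩ := exists_word_length_eq hS γ
  refine ⟨l.attach.map fun x => ⟨x.1, ?_⟩, ?_, ?_⟩
  · exact h1 x.1 x.2
  · simpa [h3] using hγ
  · simp [List.map_map, Function.comp_def, h2]

theorem exists_quotientWordDist_eq (N : Subgroup Γ) [N.Normal] (g g' : Γ ⧸ N) :
    ∃ γ : Γ, (γ : Γ ⧸ N) * g = g' ∧ groupWordLength S γ = quotientWordDist S N g g' := by
  obtain ⟨γ, hγ⟩ := QuotientGroup.mk_surjective (g' * g⁻¹)
  exact Nat.sInf_mem (s := {k : ℕ | ∃ γ : Γ, (γ : Γ ⧸ N) * g = g' ∧ groupWordLength S γ = k})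
    ⟨groupWordLength S γ, γ, by rw [hγ]; simp, rfl⟩

theorem quotientWordDist_mul_le (N : Subgroup Γ) [N.Normal] (γ : Γ) (g : Γ ⧸ N) :
    quotientWordDist S N g ((γ : Γ ⧸ N) * g) ≤ groupWordLength S γ :=
  Nat.sInf_le ⟨γ, rfl, rfl⟩

theorem quotientWordDist_self (N : Subgroup Γ) [N.Normal] (g : Γ ⧸ N) :
    quotientWordDist S N g g = 0 := by
  have h := quotientWordDist_mul_le (S := S) N 1 g
  have h1 := groupWordLength_le (S := S) ([] : List Γ) (by simp)
  simp only [QuotientGroup.mk_one, one_mul, List.prod_nil, List.length_nil] at h h1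
  omega

theorem quotientWordDist_triangle (hS : Subgroup.closure S = ⊤) (N : Subgroup Γ) [N.Normal]
    (g g' g'' : Γ ⧸ N) :
    quotientWordDist S N g g'' ≤ quotientWordDist S N g g' + quotientWordDist S N g' g'' := by
  obtain ⟨γ, rfl, h⟩ := exists_quotientWordDist_eq (S := S) N g g'
  obtain ⟨γ', rfl, h'⟩ := exists_quotientWordDist_eq (S := S) N ((γ : Γ ⧸ N) * g) g''
  rw [← h, ← h', ← mul_assoc, ← QuotientGroup.mk_mul]
  refine (quotientWordDist_mul_le N _ g).trans ((groupWordLength_mul_le hS _ _).trans ?_)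
  rw [add_comm]

theorem quotientWordDist_comm (hS : Subgroup.closure S = ⊤) (N : Subgroup Γ) [N.Normal]
    (g g' : Γ ⧸ N) : quotientWordDist S N g g' = quotientWordDist S N g' g := by
  have key : ∀ g g' : Γ ⧸ N, quotientWordDist S N g' g ≤ quotientWordDist S N g g' := by
    intro g g'
    obtain ⟨γ, rfl, h⟩ := exists_quotientWordDist_eq (S := S) N g g'
    rw [← h]
    refine le_trans ?_ (groupWordLength_inv_le hS γ)
    have := quotientWordDist_mul_le (S := S) N γ⁻¹ ((γ : Γ ⧸ N) * g)
    rwa [QuotientGroup.mk_inv, inv_mul_cancel_left] at this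
  exact le_antisymm (key _ _) (key _ _)

theorem quotientWordDist_le_diam (N : Subgroup Γ) [N.Normal] [N.FiniteIndex] (g g' : Γ ⧸ N) :
    quotientWordDist S N g g' ≤ quotientWordDiam S N :=
  le_csSup (Set.finite_range _).bddAbove ⟨(g, g'), rfl⟩

end Words

/-! ### Residual chains -/

section Chains

variable {Γ : Type u} [Group Γ] {S : Set Γ} {N : ℕ → Subgroup Γ}

/-- Applied to balls of `Γ`: deep quotients are injective on any given ball. -/
theorem eventually_forall_finite_notMem (hN : Antitone N) (hN_inter : ⨅ n, N n = ⊥) {F : Set Γ}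
    (hF : F.Finite) : ∀ᶠ n in atTop, ∀ γ ∈ F, γ ∈ N n → γ = 1 := by
  rw [hF.eventually_all]
  intro γ _
  by_cases h : γ = 1
  · exact Eventually.of_forall fun _ _ => h
  · have h1 : ¬ ∀ n, γ ∈ N n := fun h1 =>
      h (Subgroup.mem_bot.1 (hN_inter ▸ Subgroup.mem_iInf.2 h1))
    push Not at h1
    obtain ⟨n, hn⟩ := h1
    filter_upwards [eventually_ge_atTop n] with m hm hγ
    exact absurd (hN hm hγ) hn

theorem isAmenableGroup_of_finite [Finite Γ] : IsAmenableGroup Γ := by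
  have h0 : (0 : ℝ) < Nat.card Γ := by exact_mod_cast Nat.card_pos
  refine ⟨fun A => A.ncard / Nat.card Γ, fun A => by positivity, ?_, fun A B h => ?_, fun γ A => ?_⟩
  · simp only [Set.ncard_univ]
    exact div_self h0.ne'
  · simp only
    rw [Set.ncard_union_eq h, ← add_div]
    push_cast
    rfl
  · simp only
    rw [Set.ncard_image_of_injective _ (mul_right_injective γ)]

/-- Together with the diameter condition this makes `a` halve at each step from some level on. An
element `γ` of length at least `2` keeps distance at least `2` from `1` once `N n` contains no `b⁻¹
* γ` with `b` in the unit ball. -/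
theorem eventually_two_le_quotientWordDiam [∀ n, (N n).Normal] [∀ n, (N n).FiniteIndex]
    (hfin : S.Finite) (hS : Subgroup.closure S = ⊤) (hΓ : ¬ Finite Γ)
    (hN : Antitone N) (hN_inter : ⨅ n, N n = ⊥) :
    ∀ᶠ n in atTop, 2 ≤ quotientWordDiam S (N n) := by
  have hB := finite_groupWordLength_le hfin hS 1
  obtain ⟨γ, hγ⟩ : ∃ γ : Γ, ¬ groupWordLength S γ ≤ 1 := by
    by_contra! h
    exact hΓ (Set.finite_univ_iff.1 (hB.subset fun γ _ => h γ))
  filter_upwards [eventually_forall_finite_notMem hN hN_inter (hB.image fun b => b⁻¹ * γ)]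
    with n hn
  refine le_trans ?_ (quotientWordDist_le_diam (N n) 1 (γ : Γ ⧸ N n))
  by_contra! h
  obtain ⟨b, hb, hb'⟩ := exists_quotientWordDist_eq (S := S) (N n) 1 (γ : Γ ⧸ N n)
  rw [mul_one, QuotientGroup.eq] at hb
  have h1 := hn _ ⟨b, show groupWordLength S b ≤ 1 by omega, rfl⟩ hb
  rw [inv_mul_eq_one] at h1
  exact hγ (h1 ▸ (by omega))

variable [∀ n, (N n).Normal] {hN : Antitone N}

theorem GroupCompletion.eq_of_le {g g' : GroupCompletion N hN} {m n : ℕ} (hmn : m ≤ n)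
    (h : g.1 n = g'.1 n) : g.1 m = g'.1 m := by
  induction n, hmn using Nat.le_induction with
  | base => exact h
  | succ n _ ih => exact ih (by rw [← g.2 n, ← g'.2 n, h])

theorem GroupCompletion.smul_val (γ : Γ) (g : GroupCompletion N hN) (n : ℕ) :
    (γ • g).1 n = (γ : Γ ⧸ N n) * g.1 n := rfl

/-- The image of the neutral element in the completion. -/
def GroupCompletion.base (N : ℕ → Subgroup Γ) [∀ n, (N n).Normal] (hN : Antitone N) :
    GroupCompletion N hN :=
  (1 : completionSubgroup N hN)

theorem GroupCompletion.smul_base_val (γ : Γ) (n : ℕ) :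
    (γ • GroupCompletion.base N hN).1 n = (γ : Γ ⧸ N n) :=
  mul_one (γ : Γ ⧸ N n)

theorem le_completionDist {a : ℕ → ℝ} (ha_pos : ∀ n, 0 < a n) (ha_lim : Tendsto a atTop (𝓝 0))
    {g g' : GroupCompletion N hN} {n : ℕ} (h : g.1 n ≠ g'.1 n) : a n ≤ completionDist a g g' := by
  classical
  obtain ⟨C, hC⟩ := ha_lim.bddAbove_range
  have hb : BddAbove (Set.range fun n => a n * (if g.1 n = g'.1 n then (0 : ℝ) else 1)) := by
    refine ⟨C, ?_⟩
    rintro _ ⟨n, rfl⟩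
    have h1 := ha_pos n
    have h2 : a n ≤ C := hC ⟨n, rfl⟩
    dsimp only
    split_ifs <;> linarith
  have := le_ciSup hb n
  simp only [if_neg h, mul_one] at this
  unfold completionDist
  convert this

theorem completionDist_le {a : ℕ → ℝ} {n : ℕ} {c : ℝ} (hc : 0 ≤ c) (ha : ∀ m, n < m → a m ≤ c)
    {g g' : GroupCompletion N hN} (h : g.1 n = g'.1 n) : completionDist a g g' ≤ c := by
  classical
  unfold completionDist
  refine ciSup_le fun m => ?_
  split_ifs with hm
  · simpa using hc
  · rw [mul_one]
    refine ha m ?_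
    by_contra! hmn
    exact hm (GroupCompletion.eq_of_le hmn h)

theorem warpedConeDist_smul_le {Y : Type v} [MulAction Γ Y] {d : Y → Y → ℝ}
    (hS : Subgroup.closure S = ⊤) (hd : IsMetric d) (γ : Γ) (x : MetricCone Y) :
    warpedConeDist S d x (γ • x) ≤ groupWordLength S γ := by
  have hw := warpedConeDist_isWarpedBound S hd
  obtain ⟨l, h1, rfl, h3⟩ := exists_word_length_eq hS γ
  rw [← h3]
  clear h3
  induction l with
  | nil => simp [hw.isMetric.self]
  | cons s l ih =>
    have h2 := ih fun s hs => h1 s (List.mem_cons_of_mem _ hs)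
    have h4 : warpedConeDist S d (l.prod • x) ((s * l.prod) • x) ≤ 1 := by
      rw [mul_smul]
      rcases h1 s List.mem_cons_self with h | h
      · exact hw.smul_le_one s h _
      · have := hw.smul_le_one _ h (s • l.prod • x)
        rwa [inv_smul_smul, hw.isMetric.symm] at this
    have h5 := hw.isMetric.triangle x (l.prod • x) ((s * l.prod) • x)
    simp only [List.prod_cons, List.length_cons, Nat.cast_add, Nat.cast_one]
    linarith

/-- Two points of the cone of the completion with the same radius: move along the action until
the `n`-th coordinates agree, then along the fibre. -/
theorem warpedConeDist_le_of_radius_eq {a : ℕ → ℝ} (ha_pos : ∀ n, 0 < a n)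
    (ha_lim : Tendsto a atTop (𝓝 0)) (hS : Subgroup.closure S = ⊤) {n : ℕ}
    (ha : ∀ m, n < m → a m ≤ a (n + 1)) {x y : MetricCone (GroupCompletion N hN)}
    (hxy : x.radius = y.radius) :
    warpedConeDist S (completionDist a) x y ≤
      quotientWordDist S (N n) (x.point.1 n) (y.point.1 n) + x.radius * a (n + 1) := by
  have hd := completionDist_isMetric (hN := hN) ha_pos ha_lim
  have hw := warpedConeDist_isWarpedBound S hd
  obtain ⟨γ, h1, h2⟩ := exists_quotientWordDist_eq (S := S) (N n) (x.point.1 n) (y.point.1 n)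
  have h3 := warpedConeDist_smul_le hS hd γ x
  rw [h2] at h3
  have h4 : warpedConeDist S (completionDist a) (γ • x) y ≤ x.radius * a (n + 1) := by
    refine (hw.le_dist _ _).trans ?_
    change |x.radius - y.radius| + min x.radius y.radius *
      completionDist a (γ • x.point) y.point ≤ _
    rw [← hxy, sub_self, abs_zero, zero_add, min_self]
    exact mul_le_mul_of_nonneg_left (completionDist_le (ha_pos _).le ha h1)
      (zero_le_one.trans x.one_le)
  linarith [hw.isMetric.triangle x (γ • x) y]

end Chains

/-! ### Coarse embedding of warped cones from uniform embeddings of coordinates -/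

/-- The continuous step from `0` at `k + 1` to `1` at `k + 2`. -/
noncomputable def ramp (k : ℕ) (s : ℝ) : ℝ := max 0 (min 1 (s - (k + 1)))

theorem ramp_nonneg (k : ℕ) (s : ℝ) : 0 ≤ ramp k s := le_max_left _ _

theorem ramp_le_one (k : ℕ) (s : ℝ) : ramp k s ≤ 1 := max_le zero_le_one (min_le_left _ _)

theorem ramp_mono (k : ℕ) : Monotone (ramp k) := fun s t h =>
  max_le_max le_rfl (min_le_min le_rfl (by linarith))

theorem ramp_eq_zero {k : ℕ} {s : ℝ} (h : s ≤ k + 1) : ramp k s = 0 :=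
  max_eq_left ((min_le_right _ _).trans (by linarith))

theorem ramp_eq_one {k : ℕ} {s : ℝ} (h : (k : ℝ) + 2 ≤ s) : ramp k s = 1 := by
  rw [ramp, min_eq_left (by linarith), max_eq_right zero_le_one]

/-- The intervals on which the ramps rise tile `[1, K + 1]`. -/
theorem sum_ramp (K : ℕ) (s : ℝ) : ∑ k ∈ Finset.range K, ramp k s = max 0 (min (K : ℝ) (s - 1)) := by
  induction K with
  | zero => simp
  | succ K ih =>
    rw [Finset.sum_range_succ, ih, ramp]
    have : (0 : ℝ) ≤ K := by positivity
    push_cast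
    simp only [max_def, min_def]
    split_ifs <;> linarith

theorem sum_ramp_le (K : ℕ) {s : ℝ} (hs : 0 ≤ s) : ∑ k ∈ Finset.range K, ramp k s ≤ s := by
  rw [sum_ramp]
  exact max_le hs ((min_le_right _ _).trans (by linarith))

/-- All ramps are monotone, so the absolute values drop out and the sum is the increment of a
`1`-Lipschitz function. The bound does not depend on the number of scales. -/
theorem sum_abs_ramp_sub_le (K : ℕ) (s t : ℝ) :
    ∑ k ∈ Finset.range K, |ramp k s - ramp k t| ≤ |s - t| := by
  have key : ∀ s t : ℝ, t ≤ s → ∑ k ∈ Finset.range K, |ramp k s - ramp k t| ≤ |s - t| := by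
    intro s t h
    rw [abs_of_nonneg (sub_nonneg.2 h), Finset.sum_congr rfl fun k _ =>
      abs_of_nonneg (sub_nonneg.2 (ramp_mono k h)), Finset.sum_sub_distrib, sum_ramp, sum_ramp]
    have : (0 : ℝ) ≤ K := by positivity
    simp only [max_def, min_def]
    split_ifs <;> linarith
  rcases le_total t s with h | h
  · exact key s t h
  · simpa only [abs_sub_comm] using key t s h

/-- The weight of the coordinate `j` at scale `k + 1` and radius `t`. -/
noncomputable def coneWeight (α : ℕ → ℝ) (j k : ℕ) (t : ℝ) : ℝ :=
  ramp k (t * α j) - ramp k (t * α (j + 1))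

section Weights

variable {α : ℕ → ℝ}

theorem coneWeight_nonneg (hα : Antitone α) {t : ℝ} (ht : 0 ≤ t) (j k : ℕ) :
    0 ≤ coneWeight α j k t :=
  sub_nonneg.2 (ramp_mono k (mul_le_mul_of_nonneg_left (hα j.le_succ) ht))

theorem coneWeight_le_one (j k : ℕ) (t : ℝ) : coneWeight α j k t ≤ 1 := by
  have h1 := ramp_le_one k (t * α j)
  have h2 := ramp_nonneg k (t * α (j + 1))
  unfold coneWeight
  linarith

theorem coneWeight_eq_one {j k : ℕ} {t : ℝ} (h1 : (k : ℝ) + 2 ≤ t * α j)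
    (h2 : t * α (j + 1) ≤ k + 1) : coneWeight α j k t = 1 := by
  rw [coneWeight, ramp_eq_one h1, ramp_eq_zero h2, sub_zero]

/-- The sum telescopes over the levels. In use, `m` is the first level at which two points differ.
-/
theorem sum_coneWeight_le (m J k : ℕ) (t : ℝ) :
    ∑ j ∈ Finset.Ico m J, coneWeight α j k t ≤ ramp k (t * α m) := by
  rcases le_total J m with h | h
  · rw [Finset.Ico_eq_empty_of_le h, Finset.sum_empty]
    exact ramp_nonneg _ _
  · have h1 := Finset.sum_Ico_sub (fun j => -ramp k (t * α j)) h
    have h2 : ∑ j ∈ Finset.Ico m J, coneWeight α j k t =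
        ∑ j ∈ Finset.Ico m J, (-ramp k (t * α (j + 1)) - -ramp k (t * α j)) :=
      Finset.sum_congr rfl fun j _ => by rw [coneWeight]; ring
    rw [h2, h1]
    linarith [ramp_nonneg k (t * α J)]

theorem sum_sum_coneWeight_le (hα_pos : ∀ j, 0 ≤ α j) {t : ℝ} (ht : 0 ≤ t) (m J K : ℕ) :
    ∑ k ∈ Finset.range K, ∑ j ∈ Finset.Ico m J, coneWeight α j k t ≤ t * α m :=
  (Finset.sum_le_sum fun k _ => sum_coneWeight_le m J k t).trans
    (sum_ramp_le K (mul_nonneg ht (hα_pos m)))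

/-- Level `j` contributes at most `2 * α j * |t - t'|`; hence the need for summable `α`. -/
theorem sum_sum_abs_coneWeight_sub_le (hα : Antitone α) (hα_pos : ∀ j, 0 ≤ α j) {A : ℝ}
    (hA : ∀ J, ∑ j ∈ Finset.range J, α j ≤ A) (t t' : ℝ) (J K : ℕ) :
    ∑ k ∈ Finset.range K, ∑ j ∈ Finset.range J, |coneWeight α j k t - coneWeight α j k t'| ≤
      2 * A * |t - t'| := by
  rw [Finset.sum_comm]
  have h : ∀ j, ∑ k ∈ Finset.range K, |coneWeight α j k t - coneWeight α j k t'| ≤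
      2 * |t - t'| * α j := by
    intro j
    have h1 := sum_abs_ramp_sub_le K (t * α j) (t' * α j)
    have h2 := sum_abs_ramp_sub_le K (t * α (j + 1)) (t' * α (j + 1))
    rw [← sub_mul, abs_mul, abs_of_nonneg (hα_pos _)] at h1 h2
    have h3 : ∀ k, |coneWeight α j k t - coneWeight α j k t'| ≤
        |ramp k (t * α j) - ramp k (t' * α j)| +
          |ramp k (t * α (j + 1)) - ramp k (t' * α (j + 1))| := by
      intro k
      refine le_trans (le_of_eq ?_) (abs_sub _ _)
      rw [coneWeight, coneWeight]
      ring_nf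
    refine (Finset.sum_le_sum fun k _ => h3 k).trans ?_
    rw [Finset.sum_add_distrib]
    have h4 := mul_le_mul_of_nonneg_left (hα j.le_succ) (abs_nonneg (t - t'))
    simp only [Nat.succ_eq_add_one] at h4
    linarith
  refine (Finset.sum_le_sum fun j _ => h j).trans ?_
  rw [← Finset.mul_sum]
  have := mul_le_mul_of_nonneg_left (hA J) (abs_nonneg (t - t'))
  linarith

end Weights

theorem sum_inv_sq_le_two (K : ℕ) : ∑ k ∈ Finset.range K, (1 / ((k : ℝ) + 1)) ^ 2 ≤ 2 := by
  -- The subtracted remainder lets the induction close.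
  have h : ∑ k ∈ Finset.range K, (1 / ((k : ℝ) + 1)) ^ 2 ≤ 2 - 2 / ((K : ℝ) + 1) := by
    induction K with
    | zero => norm_num
    | succ K ih =>
      rw [Finset.sum_range_succ]
      have hK : (0 : ℝ) ≤ K := by positivity
      have h1 : 0 ≤ (K : ℝ) / (((K : ℝ) + 1) ^ 2 * (K + 1 + 1)) := by positivity
      have h2 : 2 - 2 / ((K : ℝ) + 1 + 1) - (2 - 2 / (K + 1) + (1 / (K + 1)) ^ 2) =
          K / (((K : ℝ) + 1) ^ 2 * (K + 1 + 1)) := by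
        field_simp
        ring
      push_cast
      linarith
  refine h.trans ?_
  have : 0 ≤ 2 / ((K : ℝ) + 1) := by positivity
  linarith

/-! ### The weighted sum of Gaussian maps: Lipschitz bound and properness. -/

section Embedding

variable {Γ : Type v} [Group Γ] {Y : Type u} [MulAction Γ Y] {S : Set Γ} {d : Y → Y → ℝ}
  {T : Type u} [NormedAddCommGroup T] [InnerProductSpace ℝ T]

/-- The weighted sum of bounded maps `P j k`, with weights depending on the radius, is well defined
and Lipschitz on the warped cone. -/
theorem exists_lipschitz_weighted_sum (hd : IsMetric d) {α : ℕ → ℝ} (hα : Antitone α)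
    (hα_pos : ∀ j, 0 ≤ α j) {A : ℝ} (hA : ∀ J, ∑ j ∈ Finset.range J, α j ≤ A)
    {P : ℕ → ℕ → Y → T} (hP : ∀ j k y, ‖P j k y‖ ≤ 1)
    (hPd : ∀ j k y y', P j k y ≠ P j k y' → α j ≤ d y y') {L : ℝ} (hL : 0 ≤ L)
    (hPS : ∀ s ∈ S, ∀ j k y, ‖P j k y - P j k (s • y)‖ ≤ L * (1 / (k + 1))) :
    ∃ F : MetricCone Y → lp (fun _ : ℕ × ℕ => T) 2,
      (∀ x j k, F x (j, k) = coneWeight α j k x.radius • P j k x.point) ∧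
      ∃ C, 0 < C ∧ ∀ x y, ‖F x - F y‖ ≤ C * warpedConeDist S d x y := by
  have hr : ∀ x : MetricCone Y, 0 ≤ x.radius := fun x => zero_le_one.trans x.one_le
  have hA0 : 0 ≤ A := by simpa using hA 0
  have hw : ∀ (x : MetricCone Y) j k, 0 ≤ coneWeight α j k x.radius := fun x =>
    coneWeight_nonneg hα (hr x)
  have hmem : ∀ x : MetricCone Y,
      Memℓp (fun i : ℕ × ℕ => coneWeight α i.1 i.2 x.radius • P i.1 i.2 x.point) 2 := by
    intro x
    refine memℓp_two_of_sum_norm_le (B := x.radius * α 0)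
      (sum_le_of_forall_range_prod_le (fun i => norm_nonneg _) fun J K => ?_)
    refine le_trans ?_ (sum_sum_coneWeight_le hα_pos (hr x) 0 J K)
    rw [← Finset.range_eq_Ico]
    refine Finset.sum_le_sum fun k _ => Finset.sum_le_sum fun j _ => ?_
    rw [norm_smul, Real.norm_of_nonneg (hw x j k)]
    exact mul_le_of_le_one_right (hw x j k) (hP j k _)
  refine ⟨fun x => ⟨_, hmem x⟩, fun x j k => rfl, 2 * A + 2 + 2 * L, by positivity, ?_⟩
  have hF : ∀ x y : MetricCone Y, ∀ i : ℕ × ℕ,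
      ((⟨_, hmem x⟩ : lp (fun _ : ℕ × ℕ => T) 2) - ⟨_, hmem y⟩ : lp (fun _ : ℕ × ℕ => T) 2) i =
      coneWeight α i.1 i.2 x.radius • P i.1 i.2 x.point -
        coneWeight α i.1 i.2 y.radius • P i.1 i.2 y.point := fun x y i => rfl
  refine norm_sub_le_mul_warpedConeDist hd (by positivity) (fun x y hxy => ?_)
    (fun x y hxy => ?_) (fun s hs x => ?_)
  · refine le_trans (b := 2 * A * |x.radius - y.radius|) ?_
      (mul_le_mul_of_nonneg_right (by linarith) (abs_nonneg _))
    refine lp_two_norm_le_of_sum_norm_le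
      (sum_le_of_forall_range_prod_le (fun i => norm_nonneg _) fun J K => ?_)
    refine le_trans ?_ (sum_sum_abs_coneWeight_sub_le hα hα_pos hA x.radius y.radius J K)
    refine Finset.sum_le_sum fun k _ => Finset.sum_le_sum fun j _ => ?_
    rw [hF, hxy, ← sub_smul, norm_smul, Real.norm_eq_abs]
    exact mul_le_of_le_one_right (abs_nonneg _) (hP j k _)
  · refine le_trans (b := 2 * (x.radius * d x.point y.point)) ?_
      (mul_le_mul_of_nonneg_right (by linarith) (mul_nonneg (hr x) (hd.nonneg _ _)))
    refine lp_two_norm_le_of_sum_norm_le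
      (sum_le_of_forall_range_prod_le (fun i => norm_nonneg _) fun J K => ?_)
    have hn : ∀ j k, ‖coneWeight α j k x.radius • P j k x.point -
        coneWeight α j k y.radius • P j k y.point‖ ≤ 2 * coneWeight α j k x.radius := by
      intro j k
      rw [← hxy, ← smul_sub, norm_smul, Real.norm_of_nonneg (hw x j k), mul_comm]
      refine mul_le_mul_of_nonneg_right ?_ (hw x j k)
      linarith [norm_sub_le (P j k x.point) (P j k y.point), hP j k x.point, hP j k y.point]
    by_cases hne : ∃ j, ∃ k, P j k x.point ≠ P j k y.point
    · classical
      -- Only levels from the first separating level `m` on contribute. Their weights add up to at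
      -- most `x.radius * α m`, which the cost of the fibre move dominates.
      obtain ⟨k, hk⟩ := Nat.find_spec hne
      have hlt : ∀ j < Nat.find hne, ∀ k, P j k x.point = P j k y.point := fun j hj k => by
        by_contra h
        exact Nat.find_min hne hj ⟨k, h⟩
      set m := Nat.find hne
      calc _ ≤ ∑ k ∈ Finset.range K, ∑ j ∈ Finset.Ico m J, 2 * coneWeight α j k x.radius := by
            refine Finset.sum_le_sum fun k _ => ?_
            have hsub : Finset.Ico m J ⊆ Finset.range J := fun j hj =>
              Finset.mem_range.2 (Finset.mem_Ico.1 hj).2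
            rw [← Finset.sum_subset hsub]
            · exact Finset.sum_le_sum fun j _ => by rw [hF]; exact hn j k
            · intro j hj hj'
              rw [hF, ← hxy, hlt j (by simp at hj hj'; omega) k, sub_self, norm_zero]
        _ = 2 * ∑ k ∈ Finset.range K, ∑ j ∈ Finset.Ico m J, coneWeight α j k x.radius := by
            simp only [Finset.mul_sum]
        _ ≤ 2 * (x.radius * α m) :=
            mul_le_mul_of_nonneg_left (sum_sum_coneWeight_le hα_pos (hr x) m J K) zero_le_two
        _ ≤ _ := mul_le_mul_of_nonneg_left
            (mul_le_mul_of_nonneg_left (hPd m k _ _ hk) (hr x)) zero_le_two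
    · push Not at hne
      refine le_trans (le_of_eq ?_)
        (mul_nonneg zero_le_two (mul_nonneg (hr x) (hd.nonneg x.point y.point)))
      refine Finset.sum_eq_zero fun k _ => Finset.sum_eq_zero fun j _ => ?_
      rw [hF, ← hxy, hne, sub_self, norm_zero]
  -- Sums of norms would leave a harmonic series in `k`, so squares are summed here. Squared weights
  -- are at most the weights, whose sum over `j` is at most `1`.
  · refine le_trans (b := 2 * L) ?_ (by linarith)
    refine lp_two_norm_le_of_sum_sq_le (by positivity)
      (sum_le_of_forall_range_prod_le (fun i => by positivity) fun J K => ?_)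
    have hn : ∀ j k, ‖coneWeight α j k x.radius • P j k x.point -
        coneWeight α j k (s • x).radius • P j k (s • x).point‖ ^ 2 ≤
          (L * (1 / (k + 1))) ^ 2 * coneWeight α j k x.radius := by
      intro j k
      change ‖coneWeight α j k x.radius • P j k x.point -
        coneWeight α j k x.radius • P j k (s • x.point)‖ ^ 2 ≤ _
      rw [← smul_sub, norm_smul, Real.norm_of_nonneg (hw x j k), mul_pow, mul_comm]
      refine mul_le_mul (pow_le_pow_left₀ (norm_nonneg _) (hPS s hs j k _) 2) ?_ (by positivity)
        (by positivity)
      exact pow_le_of_le_one (hw x j k) (coneWeight_le_one j k _) two_ne_zero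
    calc _ ≤ ∑ k ∈ Finset.range K, ∑ j ∈ Finset.range J,
          (L * (1 / ((k : ℝ) + 1))) ^ 2 * coneWeight α j k x.radius :=
          Finset.sum_le_sum fun k _ => Finset.sum_le_sum fun j _ => by rw [hF]; exact hn j k
      _ ≤ ∑ k ∈ Finset.range K, L ^ 2 * (1 / ((k : ℝ) + 1)) ^ 2 := by
          refine Finset.sum_le_sum fun k _ => ?_
          rw [← Finset.mul_sum, mul_pow]
          refine mul_le_of_le_one_right (by positivity) ?_
          rw [Finset.range_eq_Ico]
          exact (sum_coneWeight_le 0 J k _).trans (ramp_le_one _ _)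
      _ ≤ L ^ 2 * 2 := by
          rw [← Finset.mul_sum]
          exact mul_le_mul_of_nonneg_left (sum_inv_sq_le_two K) (by positivity)
      _ ≤ (2 * L) ^ 2 := by nlinarith [sq_nonneg L]

variable {α : ℕ → ℝ} {P : ℕ → ℕ → Y → T} {F : MetricCone Y → lp (fun _ : ℕ × ℕ => T) 2}

/-- If the images of two points of the same radius are close, few scales separate them. -/
theorem min_lt_of_norm_weighted_sum_le
    (hF : ∀ x j k, F x (j, k) = coneWeight α j k x.radius • P j k x.point)
    (hα_pos : ∀ j, 0 ≤ α j) {φ : ℕ → Y → Y → ℝ}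
    (hφ : ∀ j (k : ℕ) y y', (k : ℝ) + 1 ≤ φ j y y' → 1 / 2 ≤ ‖P j k y - P j k y'‖)
    {M : ℝ} {L : ℕ} (hL : 4 * M ^ 2 < L) {x y : MetricCone Y} (hxy : x.radius = y.radius)
    (hM : ‖F x - F y‖ ≤ M) (j : ℕ) :
    min (x.radius * α j) (φ j x.point y.point) < x.radius * α (j + 1) + L + 3 := by
  by_contra! h
  obtain ⟨h1, h2⟩ := le_min_iff.1 h
  have h0 : 0 ≤ x.radius * α (j + 1) := mul_nonneg (zero_le_one.trans x.one_le) (hα_pos _)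
  set k₀ := ⌈x.radius * α (j + 1)⌉₊
  have hk₁ : x.radius * α (j + 1) ≤ k₀ := Nat.le_ceil _
  have hk₂ : (k₀ : ℝ) < x.radius * α (j + 1) + 1 := Nat.ceil_lt_add_one h0
  -- The `L` consecutive scales from `k₀` on all have weight `1` and separate the points by at least
  -- `1 / 2`, so they contribute at least `L / 4 > M ^ 2`.
  have hs := lp.sum_rpow_le_norm_rpow (p := 2) (by simp) (F x - F y)
    ((Finset.range L).image fun i => (j, k₀ + i))
  rw [Finset.sum_image (by intro a _ b _ hab; simpa using hab)] at hs
  simp only [ENNReal.toReal_ofNat, Real.rpow_ofNat] at hs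
  have hterm : ∀ i ∈ Finset.range L, (1 / 4 : ℝ) ≤ ‖(F x - F y) (j, k₀ + i)‖ ^ 2 := by
    intro i hi
    have hi' : (i : ℝ) + 1 ≤ L := by exact_mod_cast Finset.mem_range.1 hi
    have hw : coneWeight α j (k₀ + i) x.radius = 1 :=
      coneWeight_eq_one (by push_cast; linarith)
        (by push_cast; linarith [(Nat.cast_nonneg i : (0 : ℝ) ≤ i)])
    have he : (F x - F y) (j, k₀ + i) = P j (k₀ + i) x.point - P j (k₀ + i) y.point := by
      change F x (j, k₀ + i) - F y (j, k₀ + i) = _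
      rw [hF, hF, ← hxy, hw, one_smul, one_smul]
    rw [he]
    have := hφ j (k₀ + i) x.point y.point (by push_cast; linarith)
    nlinarith
  have h3 := Finset.card_nsmul_le_sum _ _ _ hterm
  rw [Finset.card_range, nsmul_eq_mul] at h3
  have h4 := pow_le_pow_left₀ (norm_nonneg _) hM 2
  linarith

/-- Let `n` be the first level below which fibre moves cost less than `1`. If `φ n` is small, `δ n`
bounds the distance. Otherwise `x.radius * α n` is small and level `n - 1` serves: either `φ (n -
1)` is small, or `x.radius * α (n - 1)` is, and then `hαδ` bounds `δ (n - 1)` because `x.radius * α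
n ≥ 1`. -/
theorem warpedConeDist_bounded_of_norm_weighted_sum_le
    (hF : ∀ x j k, F x (j, k) = coneWeight α j k x.radius • P j k x.point)
    (hα_pos : ∀ j, 0 ≤ α j) (hα_lim : Tendsto α atTop (𝓝 0)) {φ δ : ℕ → Y → Y → ℝ}
    (hφ : ∀ j (k : ℕ) y y', (k : ℝ) + 1 ≤ φ j y y' → 1 / 2 ≤ ‖P j k y - P j k y'‖)
    (hδ : ∀ j (x y : MetricCone Y), x.radius = y.radius →
      warpedConeDist S d x y ≤ δ j x.point y.point + x.radius * α (j + 1))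
    (hδ0 : ∀ j y y', 0 ≤ δ j y y') (hαδ : ∀ j y y', α (j + 1) * δ j y y' ≤ α j)
    {Δ : ℝ} (hΔ : ∀ y y', δ 0 y y' ≤ Δ)
    (hφδ : ∀ M : ℝ, ∃ D : ℝ, 0 ≤ D ∧ ∀ j y y', φ j y y' ≤ M → δ j y y' ≤ D) (M : ℝ) :
    ∃ K : ℝ, ∀ x y : MetricCone Y, x.radius = y.radius → ‖F x - F y‖ ≤ M →
      warpedConeDist S d x y ≤ K := by
  classical
  obtain ⟨L, hL⟩ := exists_nat_gt (4 * M ^ 2)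
  -- The thresholds come from applying `hmin` twice: `1 + L + 3` at level `m + 1`, then `(L + 4) + L
  -- + 3` at level `m`.
  obtain ⟨D₁, hD₁, h₁⟩ := hφδ (L + 4)
  obtain ⟨D₂, hD₂, h₂⟩ := hφδ (2 * L + 7)
  refine ⟨|Δ| + D₁ + D₂ + 3 * L + 11, fun x y hxy hM => ?_⟩
  have hL0 : (0 : ℝ) ≤ L := by positivity
  have hΔ0 := abs_nonneg Δ
  have hx : 0 ≤ x.radius := zero_le_one.trans x.one_le
  have hmin := min_lt_of_norm_weighted_sum_le hF hα_pos hφ hL hxy hM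
  have hex : ∃ n, x.radius * α (n + 1) < 1 := by
    have h := (hα_lim.comp (tendsto_add_atTop_nat 1)).const_mul x.radius
    rw [mul_zero] at h
    exact (h.eventually (gt_mem_nhds zero_lt_one)).exists
  have hspec := Nat.find_spec hex
  rcases h : Nat.find hex with _ | m
  · rw [h] at hspec
    linarith [hδ 0 x y hxy, hΔ x.point y.point, le_abs_self Δ]
  · have hm := Nat.find_min hex (m := m) (by omega)
    rw [h] at hspec
    rw [not_lt] at hm
    rcases min_lt_iff.1 (hmin (m + 1)) with h3 | h3
    · rcases min_lt_iff.1 (hmin m) with h4 | h4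
      · have h5 := mul_le_mul_of_nonneg_left (hαδ m x.point y.point) hx
        have h6 := mul_le_mul_of_nonneg_right hm (hδ0 m x.point y.point)
        have h7 := hδ m x y hxy
        nlinarith
      · linarith [hδ m x y hxy, h₂ m x.point y.point (by linarith)]
    · linarith [hδ (m + 1) x y hxy, h₁ (m + 1) x.point y.point (by linarith)]

end Embedding

/-- Here `δ j` stands for the word distance at level `j`, and `α j` for the fibre distance at which
level `j` becomes visible. -/
theorem embedsCoarsely_warpedConeDist {Γ : Type v} [Group Γ] {Y : Type u} [MulAction Γ Y]
    {S : Set Γ} {d : Y → Y → ℝ} (hd : IsMetric d) {α : ℕ → ℝ} (hα : Antitone α)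
    (hα_pos : ∀ j, 0 ≤ α j) (hα_lim : Tendsto α atTop (𝓝 0)) {A : ℝ}
    (hA : ∀ J, ∑ j ∈ Finset.range J, α j ≤ A)
    {H : Type u} [NormedAddCommGroup H] [InnerProductSpace ℝ H] {f : ℕ → Y → H}
    (hfd : ∀ j y y', f j y ≠ f j y' → α j ≤ d y y') {L : ℝ} (hL : 0 ≤ L)
    (hfS : ∀ s ∈ S, ∀ j y, ‖f j y - f j (s • y)‖ ≤ L) {δ : ℕ → Y → Y → ℝ}
    (hδ : ∀ j (x y : MetricCone Y), x.radius = y.radius →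
      warpedConeDist S d x y ≤ δ j x.point y.point + x.radius * α (j + 1))
    (hδ0 : ∀ j y y', 0 ≤ δ j y y') (hαδ : ∀ j y y', α (j + 1) * δ j y y' ≤ α j)
    {Δ : ℝ} (hΔ : ∀ y y', δ 0 y y' ≤ Δ)
    (hfδ : ∀ M : ℝ, ∃ D : ℝ, 0 ≤ D ∧ ∀ j y y', ‖f j y - f j y'‖ ≤ M → δ j y y' ≤ D) :
    EmbedsCoarselyIntoHilbert (warpedConeDist S d) := by
  obtain ⟨T, _, _, _, E, hE1, hE2, hE3⟩ := exists_bounded_separating_map H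
  let P : ℕ → ℕ → Y → T := fun j k y => E ((1 / ((k : ℝ) + 1)) • f j y)
  have hdist : ∀ j (k : ℕ) y y', ‖(1 / ((k : ℝ) + 1)) • f j y - (1 / ((k : ℝ) + 1)) • f j y'‖ =
      1 / ((k : ℝ) + 1) * ‖f j y - f j y'‖ := by
    intro j k y y'
    rw [← smul_sub, norm_smul, Real.norm_of_nonneg (by positivity)]
  obtain ⟨F, hF, C, hC, hlip⟩ := exists_lipschitz_weighted_sum (S := S) hd hα hα_pos hA (P := P)
    (fun j k y => hE1 _) (fun j k y y' h => hfd j y y' fun h' => h (by simp only [P, h'])) hL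
    (fun s hs j k y => (hE2 _ _).trans (by
      rw [hdist, mul_comm]
      exact mul_le_mul_of_nonneg_right (hfS s hs j y) (by positivity)))
  have hprop := warpedConeDist_bounded_of_norm_weighted_sum_le (S := S) (d := d) hF hα_pos hα_lim
    (φ := fun j y y' => ‖f j y - f j y'‖) (fun j k y y' h => hE3 _ _ (by
      rw [hdist, one_div, ← div_eq_inv_mul, one_le_div₀ (by positivity)]
      exact h)) hδ hδ0 hαδ hΔ hfδ
  have hw := warpedConeDist_isWarpedBound S hd
  refine ⟨WithLp 2 (ℝ × lp (fun _ : ℕ × ℕ => T) 2), inferInstance, inferInstance, inferInstance,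
    fun x => WithLp.toLp 2 (x.radius, F x),
    isCoarseEmbedding_of_lipschitz (C := 1 + C) hw.isMetric.nonneg (by linarith)
      (fun x y => ?_) fun M => ?_⟩
  · have h1 := WithLp.prod_norm_sq_eq_of_L2
      (WithLp.toLp 2 (x.radius, F x) - WithLp.toLp 2 (y.radius, F y))
    have h2 : |x.radius - y.radius| ≤ warpedConeDist S d x y :=
      abs_radius_sub_le_warpedConeDist hd x y
    have h3 := hlip x y
    have h4 := hw.isMetric.nonneg x y
    refine abs_le_of_sq_le_sq' ?_ (mul_nonneg (by linarith) h4) |>.2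
    rw [h1]
    change |x.radius - y.radius| ^ 2 + ‖F x - F y‖ ^ 2 ≤ _
    have h5 := abs_nonneg (x.radius - y.radius)
    have h6 := norm_nonneg (F x - F y)
    nlinarith [mul_nonneg h5 h6, mul_nonneg hC.le h4]
  · obtain ⟨K, hK⟩ := hprop (M + C * M)
    refine ⟨K + M, fun x y hM => ?_⟩
    have h1 := WithLp.prod_norm_sq_eq_of_L2
      (WithLp.toLp 2 (x.radius, F x) - WithLp.toLp 2 (y.radius, F y))
    change _ = |x.radius - y.radius| ^ 2 + ‖F x - F y‖ ^ 2 at h1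
    have h0 := (norm_nonneg _).trans hM
    have h2 : |x.radius - y.radius| ≤ M :=
      (abs_le_of_sq_le_sq' (by nlinarith [sq_nonneg ‖F x - F y‖]) (norm_nonneg _)).2.trans hM
    have h3 : ‖F x - F y‖ ≤ M :=
      (abs_le_of_sq_le_sq' (by nlinarith [sq_nonneg |x.radius - y.radius|]) (norm_nonneg _)).2.trans
        hM
    -- Moving `y` to the radius of `x` reduces properness to equal radii.
    let z : MetricCone Y := ⟨x.radius, x.one_le, y.point⟩
    have h4 : warpedConeDist S d z y ≤ M := by
      refine (hw.le_dist z y).trans ?_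
      simpa [coneDist, z, hd.self] using h2
    have h5 : ‖F x - F z‖ ≤ M + C * M := by
      have h6 := hlip y z
      rw [hw.isMetric.symm] at h6
      have h7 := norm_sub_le_norm_sub_add_norm_sub (F x) (F y) (F z)
      have h8 := mul_le_mul_of_nonneg_left h4 hC.le
      linarith
    linarith [hK x z rfl h5, hw.isMetric.triangle x z y]

/-! ### Property A of the warped cone implies amenability -/

/-- A group with finitely additive probability measures that are almost invariant under a
generating set is amenable. -/
theorem isAmenableGroup_of_almost_invariant {Γ : Type u} [Group Γ] {S : Set Γ}
    (hS : Subgroup.closure S = ⊤)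
    (h : ∀ ε : ℝ, 0 < ε → ∃ μ : Set Γ → ℝ, (∀ A, 0 ≤ μ A) ∧ μ Set.univ = 1 ∧
      (∀ A B, Disjoint A B → μ (A ∪ B) = μ A + μ B) ∧
      ∀ s ∈ S, ∀ A : Set Γ, |μ A - μ ((fun x => s * x) '' A)| ≤ ε) : IsAmenableGroup Γ := by
  choose μ h0 h1 hadd hinv using fun k : ℕ => h (1 / ((k : ℝ) + 1)) (by positivity)
  have hle : ∀ k A, μ k A ≤ 1 := fun k A => by
    rw [← h1 k, ← Set.union_compl_self A, hadd k A Aᶜ disjoint_compl_right]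
    linarith [h0 k Aᶜ]
  -- Limits along a non-principal ultrafilter exist for all sets at once and preserve finite
  -- additivity.
  have hlim : ∀ A : Set Γ, ∃ c ∈ Set.Icc (0 : ℝ) 1,
      Tendsto (fun k => μ k A) (hyperfilter ℕ : Filter ℕ) (𝓝 c) := fun A =>
    isCompact_Icc.ultrafilter_le_nhds ((hyperfilter ℕ).map fun k => μ k A)
      (le_principal_iff.2 (Eventually.of_forall (p := fun k : ℕ => μ k A ∈ Set.Icc (0 : ℝ) 1)
        fun k => ⟨h0 k A, hle k A⟩))
  choose ν hν hνlim using hlim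
  have hS_inv : ∀ s ∈ S, ∀ A : Set Γ, ν ((fun x => s * x) '' A) = ν A := by
    intro s hs A
    have h2 : Tendsto (fun k => μ k A - μ k ((fun x => s * x) '' A)) (hyperfilter ℕ : Filter ℕ)
        (𝓝 0) :=
      squeeze_zero_norm (fun k => hinv k s hs A)
        (tendsto_one_div_add_atTop_nhds_zero_nat.mono_left Nat.hyperfilter_le_atTop)
    have h3 := tendsto_nhds_unique h2 ((hνlim A).sub (hνlim _))
    linarith
  refine ⟨ν, fun A => (hν A).1, ?_, fun A B hAB => ?_, fun γ => ?_⟩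
  · exact tendsto_nhds_unique (hνlim Set.univ) (by simp only [h1]; exact tendsto_const_nhds)
  · refine tendsto_nhds_unique (hνlim (A ∪ B)) ?_
    simp only [fun k => hadd k A B hAB]
    exact (hνlim A).add (hνlim B)
  · have hγ : γ ∈ Subgroup.closure S := hS ▸ Subgroup.mem_top γ
    induction hγ using Subgroup.closure_induction with
    | mem s hs => exact hS_inv s hs
    | one => simp
    | mul x y _ _ hx hy =>
      intro A
      rw [← hy A, ← hx ((fun z => y * z) '' A), Set.image_image]
      simp only [mul_assoc]
    | inv x _ hx =>
      intro A
      rw [← hx, Set.image_image]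
      simp

/-- Relative frequencies in two finite sets with small symmetric difference are close. -/
theorem abs_ncard_div_sub_ncard_div_le {α : Type*} {U V U' V' : Set α} (hU : U.Finite)
    (hV : V.Finite) (hU' : U' ⊆ U) (hV' : V' ⊆ V) (h : ∀ q ∈ U, q ∈ V → (q ∈ U' ↔ q ∈ V')) {ε : ℝ}
    (hε : 0 < ε) (hUV : ((symmDiff U V).ncard : ℝ) < ε * ((U ∩ V).ncard : ℝ)) :
    |(U'.ncard : ℝ) / U.ncard - (V'.ncard : ℝ) / V.ncard| ≤ 2 * ε := by
  have hfin : (symmDiff U V).Finite := hU.symmDiff hV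
  have key : ∀ {A B : Set α}, B.Finite → A ⊆ B ∪ symmDiff U V →
      (A.ncard : ℝ) ≤ B.ncard + (symmDiff U V).ncard := by
    intro A B hB hAB
    exact_mod_cast (Set.ncard_le_ncard hAB (hB.union hfin)).trans (Set.ncard_union_le _ _)
  have e1 : (U.ncard : ℝ) ≤ V.ncard + (symmDiff U V).ncard := key hV fun q hq => by
    by_cases hqV : q ∈ V
    exacts [Or.inl hqV, Or.inr (Or.inl ⟨hq, hqV⟩)]
  have e2 : (V.ncard : ℝ) ≤ U.ncard + (symmDiff U V).ncard := key hU fun q hq => by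
    by_cases hqU : q ∈ U
    exacts [Or.inl hqU, Or.inr (Or.inr ⟨hq, hqU⟩)]
  have e3 : (U'.ncard : ℝ) ≤ V'.ncard + (symmDiff U V).ncard := key (hV.subset hV') fun q hq => by
    by_cases hqV : q ∈ V
    exacts [Or.inl ((h q (hU' hq) hqV).1 hq), Or.inr (Or.inl ⟨hU' hq, hqV⟩)]
  have e4 : (V'.ncard : ℝ) ≤ U'.ncard + (symmDiff U V).ncard := key (hU.subset hU') fun q hq => by
    by_cases hqU : q ∈ U
    exacts [Or.inl ((h q hqU (hV' hq)).2 hq), Or.inr (Or.inr ⟨hV' hq, hqU⟩)]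
  have e5 : ((U ∩ V).ncard : ℝ) ≤ U.ncard := by
    exact_mod_cast Set.ncard_le_ncard Set.inter_subset_left hU
  have e6 : ((U ∩ V).ncard : ℝ) ≤ V.ncard := by
    exact_mod_cast Set.ncard_le_ncard Set.inter_subset_right hV
  have e7 : (V'.ncard : ℝ) ≤ V.ncard := by exact_mod_cast Set.ncard_le_ncard hV' hV
  have e8 : (0 : ℝ) ≤ (symmDiff U V).ncard := by positivity
  have e9 : (0 : ℝ) < (U ∩ V).ncard := by
    by_contra! h9
    nlinarith
  have e10 : (0 : ℝ) ≤ V'.ncard := by positivity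
  generalize (U.ncard : ℝ) = u at *
  generalize (V.ncard : ℝ) = w at *
  generalize (U'.ncard : ℝ) = u' at *
  generalize (V'.ncard : ℝ) = w' at *
  generalize ((symmDiff U V).ncard : ℝ) = σ at *
  have hu : 0 < u := by linarith
  have hw : 0 < w := by linarith
  have hσ : σ ≤ ε * u := hUV.le.trans (mul_le_mul_of_nonneg_left e5 hε.le)
  have h1 : |u' - w'| ≤ σ := abs_sub_le_iff.2 ⟨by linarith, by linarith⟩
  have h2 : |w - u| ≤ σ := abs_sub_le_iff.2 ⟨by linarith, by linarith⟩
  -- Splits the error into a change of numerator and a change of denominator, each at most `ε`.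
  have h3 : u' / u - w' / w = (u' - w') / u + w' / w * ((w - u) / u) := by
    field_simp
    ring
  have h4 : |w' / w| ≤ 1 := by
    rw [abs_of_nonneg (by positivity)]
    exact (div_le_one hw).2 e7
  have h5 : ∀ z : ℝ, |z| ≤ σ → |z / u| ≤ ε := fun z hz => by
    rw [abs_div, abs_of_pos hu, div_le_iff₀ hu]
    exact hz.trans hσ
  rw [h3]
  refine (abs_add_le _ _).trans ?_
  rw [abs_mul]
  have h6 := mul_le_mul h4 (h5 _ h2) (abs_nonneg _) zero_le_one
  linarith [h5 _ h1]

/-! ### Finite quotients seen in the cone, and invariant means. -/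

section

variable {Γ : Type u} [Group Γ] {S : Set Γ} {N : ℕ → Subgroup Γ} [∀ n, (N n).Normal]
  {hN : Antitone N} {a : ℕ → ℝ}

/-- The word metric of a finite quotient, truncated at a multiple of the radius, is a lower bound
for the metric of the warped cone. -/
theorem min_quotientWordDist_le_warpedConeDist (hS : Subgroup.closure S = ⊤)
    (ha_pos : ∀ n, 0 < a n) (ha_lim : Tendsto a atTop (𝓝 0)) {n : ℕ} {c : ℝ} (hc : 0 ≤ c)
    (hc1 : c ≤ 1) (hca : c ≤ a n) (x y : MetricCone (GroupCompletion N hN)) :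
    min (quotientWordDist S (N n) (x.point.1 n) (y.point.1 n) : ℝ) (c * y.radius) ≤
      warpedConeDist S (completionDist a) x y := by
  have hr : ∀ x : MetricCone (GroupCompletion N hN), 0 ≤ x.radius := fun x =>
    zero_le_one.trans x.one_le
  have hd := completionDist_isMetric (hN := hN) ha_pos ha_lim
  -- The distance from the fixed `x` is treated as a function of the second point. Truncation makes
  -- it Lipschitz along fibres: changing the `n`-th coordinate costs at least `c` times the radius,
  -- the largest possible jump.
  have h := norm_sub_le_mul_warpedConeDist (S := S) hd
    (f := fun p => min (quotientWordDist S (N n) (x.point.1 n) (p.point.1 n) : ℝ) (c * p.radius))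
    one_pos (fun p q hpq => ?_) (fun p q hpq => ?_) (fun s hs p => ?_) x y
  · rw [one_mul] at h
    refine le_trans ?_ h
    rw [quotientWordDist_self, Nat.cast_zero, min_eq_left (mul_nonneg hc (hr x)), zero_sub,
      norm_neg]
    exact le_abs_self _
  · rw [hpq, Real.norm_eq_abs]
    refine (abs_min_sub_min_le_max _ _ _ _).trans ?_
    rw [sub_self, abs_zero, one_mul, ← mul_sub, abs_mul, abs_of_nonneg hc]
    exact max_le (abs_nonneg _) (mul_le_of_le_one_left (abs_nonneg _) hc1)
  · rw [one_mul]
    by_cases he : p.point.1 n = q.point.1 n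
    · rw [he, hpq, sub_self, norm_zero]
      exact mul_nonneg (hr q) (hd.nonneg _ _)
    · have h1 : c ≤ completionDist a p.point q.point :=
        hca.trans (le_completionDist ha_pos ha_lim he)
      rw [← hpq, Real.norm_eq_abs]
      refine le_trans ?_ (mul_le_mul_of_nonneg_left h1 (hr p))
      have h2 : 0 ≤ c * p.radius := mul_nonneg hc (hr p)
      rw [mul_comm p.radius c]
      refine abs_sub_le_iff.2 ⟨?_, ?_⟩
      · have h3 := min_le_right (quotientWordDist S (N n) (x.point.1 n) (p.point.1 n) : ℝ)
          (c * p.radius)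
        have h4 : 0 ≤ min (quotientWordDist S (N n) (x.point.1 n) (q.point.1 n) : ℝ)
          (c * p.radius) := le_min (Nat.cast_nonneg _) h2
        linarith
      · have h3 := min_le_right (quotientWordDist S (N n) (x.point.1 n) (q.point.1 n) : ℝ)
          (c * p.radius)
        have h4 : 0 ≤ min (quotientWordDist S (N n) (x.point.1 n) (p.point.1 n) : ℝ)
          (c * p.radius) := le_min (Nat.cast_nonneg _) h2
        linarith
  · change ‖min (quotientWordDist S (N n) (x.point.1 n) (p.point.1 n) : ℝ) (c * p.radius) -
      min (quotientWordDist S (N n) (x.point.1 n) ((s : Γ ⧸ N n) * p.point.1 n) : ℝ)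
        (c * p.radius)‖ ≤ 1
    rw [Real.norm_eq_abs]
    refine (abs_min_sub_min_le_max _ _ _ _).trans ?_
    rw [sub_self, abs_zero]
    refine max_le ?_ zero_le_one
    have h1 := (quotientWordDist_mul_le (S := S) (N n) s (p.point.1 n)).trans
      (groupWordLength_le_one hs)
    have h2 := quotientWordDist_triangle hS (N n) (x.point.1 n) (p.point.1 n)
      ((s : Γ ⧸ N n) * p.point.1 n)
    have h3 := quotientWordDist_triangle hS (N n) (x.point.1 n) ((s : Γ ⧸ N n) * p.point.1 n)
      (p.point.1 n)
    rw [quotientWordDist_comm hS (N n) ((s : Γ ⧸ N n) * p.point.1 n)] at h3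
    have h4 : (quotientWordDist S (N n) (x.point.1 n) ((s : Γ ⧸ N n) * p.point.1 n) : ℝ) ≤
      quotientWordDist S (N n) (x.point.1 n) (p.point.1 n) + 1 := by exact_mod_cast (by omega)
    have h5 : (quotientWordDist S (N n) (x.point.1 n) (p.point.1 n) : ℝ) ≤
      quotientWordDist S (N n) (x.point.1 n) ((s : Γ ⧸ N n) * p.point.1 n) + 1 := by
        exact_mod_cast (by omega)
    exact abs_sub_le_iff.2 ⟨by linarith, by linarith⟩

theorem exists_radius_quotientWordDist_le (hS : Subgroup.closure S = ⊤)
    (ha_pos : ∀ n, 0 < a n) (ha_lim : Tendsto a atTop (𝓝 0)) (n r : ℕ) :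
    ∃ t : ℝ, 1 ≤ t ∧ ∀ x y : MetricCone (GroupCompletion N hN), x.radius = t →
      warpedConeDist S (completionDist a) x y ≤ r →
      quotientWordDist S (N n) (x.point.1 n) (y.point.1 n) ≤ r := by
  have hd := completionDist_isMetric (hN := hN) ha_pos ha_lim
  have hc : 0 < min (a n) 1 := lt_min (ha_pos n) one_pos
  set c := min (a n) 1
  -- A point within `r` of radius `t` still has radius above `r / c`, so the truncation is inactive.
  refine ⟨r / c + r + 1, ?_, fun x y hx hxy => ?_⟩
  · have : 0 ≤ (r : ℝ) / c := by positivity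
    have : (0 : ℝ) ≤ r := by positivity
    linarith
  · have h1 := (min_quotientWordDist_le_warpedConeDist hS ha_pos ha_lim hc.le (min_le_right _ _)
      (min_le_left _ _) x y).trans hxy
    have h2 := (le_abs_self _).trans ((abs_radius_sub_le_warpedConeDist (S := S) hd x y).trans hxy)
    have h3 : (r : ℝ) < c * y.radius := by
      have h4 : (r : ℝ) / c < y.radius := by linarith
      rwa [div_lt_iff₀' hc] at h4
    rcases min_le_iff.1 h1 with h | h
    · exact_mod_cast h
    · linarith

theorem isAmenableGroup_of_hasPropertyA [∀ n, (N n).FiniteIndex] (hS_finite : S.Finite)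
    (hS : Subgroup.closure S = ⊤) (hN_inter : ⨅ n, N n = ⊥) (ha_pos : ∀ n, 0 < a n)
    (ha_lim : Tendsto a atTop (𝓝 0))
    (hA : HasPropertyA
      (warpedConeDist S (completionDist a : GroupCompletion N hN → GroupCompletion N hN → ℝ))) :
    IsAmenableGroup Γ := by
  refine isAmenableGroup_of_almost_invariant hS fun ε hε => ?_
  have hd := completionDist_isMetric (hN := hN) ha_pos ha_lim
  have hw := warpedConeDist_isWarpedBound S hd
  -- Comparing frequencies doubles `ε / 2`. Neighbouring sample points are at distance at most `2`,
  -- hence strictly below `3`.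
  obtain ⟨A, hA1, hA2, r', hr'⟩ := hA (ε / 2) (by positivity) 3
  obtain ⟨r, hr⟩ := exists_nat_ge r'
  -- The radius `2 * r + 1` accommodates two elements of length at most `r` and one generator.
  obtain ⟨n, hn⟩ := (eventually_forall_finite_notMem hN hN_inter
    (finite_groupWordLength_le hS_finite hS (2 * r + 1))).exists
  obtain ⟨t, ht1, ht⟩ := exists_radius_quotientWordDist_le (hN := hN) hS ha_pos ha_lim n r
  have ht0 : 0 < t := one_pos.trans_le ht1
  -- The radius `t` depends on `n`, so a deeper level `m` is needed for fibre moves at radius `t` to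
  -- cost at most `1`.
  obtain ⟨m, hmn, hm⟩ : ∃ m, n ≤ m ∧ ∀ k, m < k → a k ≤ 1 / t := by
    have h1 := ha_lim.eventually (gt_mem_nhds (show (0 : ℝ) < 1 / t by positivity))
    obtain ⟨m, hm⟩ := eventually_atTop.1 h1
    exact ⟨max m n, le_max_right _ _, fun k hk =>
      (hm k ((le_max_left _ _).trans hk.le)).le⟩
  let x : Γ ⧸ N m → MetricCone (GroupCompletion N hN) := fun g =>
    ⟨t, ht1, g.out • GroupCompletion.base N hN⟩
  have hxm : ∀ g, (x g).point.1 m = g := fun g =>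
    (GroupCompletion.smul_base_val _ m).trans (QuotientGroup.out_eq' g)
  have hxs : ∀ (s : Γ) g, (s • (x g).point).1 m = (x ((s : Γ ⧸ N m) * g)).point.1 m := fun s g => by
    rw [GroupCompletion.smul_val, hxm, hxm]
  have hdist : ∀ s ∈ S, ∀ g,
      warpedConeDist S (completionDist a) (x g) (x ((s : Γ ⧸ N m) * g)) < 3 := by
    intro s hs g
    have h1 := hw.smul_le_one s hs (x g)
    have h2 : warpedConeDist S (completionDist a) (s • x g) (x ((s : Γ ⧸ N m) * g)) ≤ 1 := by
      refine (hw.le_dist _ _).trans ?_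
      change |t - t| + min t t *
        completionDist a (s • (x g).point) (x ((s : Γ ⧸ N m) * g)).point ≤ 1
      rw [sub_self, abs_zero, zero_add, min_self, ← le_div_iff₀' ht0]
      exact completionDist_le (by positivity) hm (hxs s g)
    linarith [hw.isMetric.triangle (x g) (s • x g) (x ((s : Γ ⧸ N m) * g))]
  -- Membership is placed under the existential so that the chosen `T` is total.
  have hT : ∀ g (q : MetricCone (GroupCompletion N hN) × ℕ), ∃ η : Γ, q ∈ A (x g) →
      groupWordLength S η ≤ r ∧ (η : Γ ⧸ N n) * (x g).point.1 n = q.1.point.1 n := by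
    intro g q
    obtain ⟨η, h1, h2⟩ := exists_quotientWordDist_eq (S := S) (N n) ((x g).point.1 n)
      (q.1.point.1 n)
    exact ⟨η, fun hq => ⟨h2 ▸ ht (x g) q.1 rfl ((hr' _ _ hq).trans hr), h1⟩⟩
  choose T hT using hT
  have hTs : ∀ s ∈ S, ∀ g q, q ∈ A (x g) → q ∈ A (x ((s : Γ ⧸ N m) * g)) →
      T g q = T ((s : Γ ⧸ N m) * g) q * s := by
    intro s hs g q h1 h2
    obtain ⟨h3, h4⟩ := hT _ _ h1
    obtain ⟨h5, h6⟩ := hT _ _ h2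
    rw [← GroupCompletion.eq_of_le hmn (hxs s g), GroupCompletion.smul_val, ← h4, ← mul_assoc,
      mul_left_inj, ← QuotientGroup.mk_mul, eq_comm, QuotientGroup.eq] at h6
    have h7 := hn _ (show groupWordLength S _ ≤ 2 * r + 1 from ?_) h6
    -- Both sides act alike in `Γ ⧸ N n` and differ by a short element, so they agree in `Γ`.
    · exact inv_mul_eq_one.1 h7
    · have h8 := groupWordLength_mul_le hS (T g q)⁻¹ (T ((s : Γ ⧸ N m) * g) q * s)
      have h9 := groupWordLength_mul_le hS (T ((s : Γ ⧸ N m) * g) q) s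
      have h10 := groupWordLength_inv_le hS (T g q)
      have h11 := groupWordLength_le_one hs
      omega
  -- Passing to inverses turns `T g q = T (s * g) q * s` into left equivariance.
  let μ : Γ ⧸ N m → Set Γ → ℝ := fun g B =>
    ({q ∈ A (x g) | (T g q)⁻¹ ∈ B}.ncard : ℝ) / (A (x g)).ncard
  have hμinv : ∀ s ∈ S, ∀ g B, |μ g B - μ ((s : Γ ⧸ N m) * g) ((fun x => s * x) '' B)| ≤ ε := by
    intro s hs g B
    refine (abs_ncard_div_sub_ncard_div_le (hA1 (x g)).1 (hA1 _).1 (Set.sep_subset _ _)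
      (Set.sep_subset _ _) (fun q h1 h2 => ?_) (by positivity)
      (hA2 _ _ (hdist s hs g))).trans_eq (by ring)
    simp only [Set.mem_ofPred_eq, h1, h2, true_and, hTs s hs g q h1 h2, mul_inv_rev,
      Set.image_mul_left, Set.mem_preimage]
  have hpos : ∀ g, (0 : ℝ) < (A (x g)).ncard := fun g => by
    exact_mod_cast (Set.ncard_pos (hA1 _).1).2 (hA1 _).2
  have : Fintype (Γ ⧸ N m) := Fintype.ofFinite _
  have hcard : (0 : ℝ) < Fintype.card (Γ ⧸ N m) := by exact_mod_cast Fintype.card_pos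
  refine ⟨fun B => (∑ g, μ g B) / Fintype.card (Γ ⧸ N m), fun B => by positivity, ?_,
    fun B C hBC => ?_, fun s hs B => ?_⟩
  · have h1 : ∀ g, μ g Set.univ = 1 := fun g => by
      simp only [μ, Set.mem_univ, and_true]
      exact div_self (hpos g).ne'
    simp only [h1, Finset.sum_const, nsmul_eq_mul, mul_one, Finset.card_univ]
    exact div_self hcard.ne'
  · have h1 : ∀ g, μ g (B ∪ C) = μ g B + μ g C := fun g => by
      simp only [μ]
      rw [← add_div, ← Nat.cast_add, ← Set.ncard_union_eq _ ((hA1 _).1.subset (Set.sep_subset _ _))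
        ((hA1 _).1.subset (Set.sep_subset _ _))]
      · congr 3
        ext q
        simp only [Set.mem_ofPred_eq, Set.mem_union]
        tauto
      · exact Set.disjoint_left.2 fun q h1 h2 => Set.disjoint_left.1 hBC h1.2 h2.2
    simp only [h1, Finset.sum_add_distrib, add_div]
  · simp only
    -- Translation by `s` permutes `Γ ⧸ N m`, so averaging absorbs the shift of base point from `g`
    -- to `s * g`.
    rw [← Equiv.sum_comp (Equiv.mulLeft (s : Γ ⧸ N m)) fun g => μ g ((fun x => s * x) '' B),
      ← sub_div, ← Finset.sum_sub_distrib, abs_div, abs_of_pos hcard, div_le_iff₀ hcard]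
    refine (Finset.abs_sum_le_sum_abs _ _).trans
      ((Finset.sum_le_sum fun g _ => hμinv s hs g B).trans_eq ?_)
    rw [Finset.sum_const, nsmul_eq_mul, Finset.card_univ, mul_comm]

end

/-! ### The completion of a residual chain and the conclusion. -/

/-- A sequence that at least halves at each step has bounded partial sums. -/
theorem sum_range_le_two_mul_of_halving {α : ℕ → ℝ} (hα_pos : ∀ j, 0 ≤ α j)
    (hα : ∀ j, 2 * α (j + 1) ≤ α j) (J : ℕ) : ∑ j ∈ Finset.range J, α j ≤ 2 * α 0 := by
  have h : ∑ j ∈ Finset.range J, α j ≤ 2 * α 0 - 2 * α J := by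
    induction J with
    | zero => simp
    | succ J ih =>
      rw [Finset.sum_range_succ]
      linarith [hα J]
  linarith [hα_pos J]

/-- The levels below `n₀` are discarded: from there on `a` halves, hence is decreasing and summable,
and the finite diameter of `Γ ⧸ N n₀` bounds the first remaining level. -/
theorem embedsCoarsely_warpedConeDist_completion {Γ : Type u} [Group Γ]
    {S : Set Γ} (hS_finite : S.Finite) (hS : Subgroup.closure S = ⊤) (hΓ : ¬ Finite Γ)
    {N : ℕ → Subgroup Γ} [∀ n, (N n).Normal] [∀ n, (N n).FiniteIndex]
    {hN : Antitone N} (hN_inter : ⨅ n, N n = ⊥)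
    {a : ℕ → ℝ} (ha_pos : ∀ n, 0 < a n) (ha_lim : Tendsto a atTop (𝓝 0))
    (ha_diam : ∀ n, a (n + 1) * (quotientWordDiam S (N n) : ℝ) < a n)
    {D : (Σ n, Γ ⧸ N n) → (Σ n, Γ ⧸ N n) → ℝ}
    (hD : ∀ n (g g' : Γ ⧸ N n), D ⟨n, g⟩ ⟨n, g'⟩ = quotientWordDist S (N n) g g')
    (hD_emb : EmbedsCoarselyIntoHilbert D) :
    EmbedsCoarselyIntoHilbert
      (warpedConeDist S (completionDist a : GroupCompletion N hN → GroupCompletion N hN → ℝ)) := by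
  obtain ⟨H, _, _, _, f, ρ₁, ρ₂, _, hρ₂, hρ₁_lim, _, hf⟩ := hD_emb
  obtain ⟨n₀, hn₀⟩ := eventually_atTop.1
    (eventually_two_le_quotientWordDiam hS_finite hS hΓ hN hN_inter)
  have hhalf : ∀ n, n₀ ≤ n → 2 * a (n + 1) ≤ a n := by
    intro n hn
    have h1 : (2 : ℝ) ≤ quotientWordDiam S (N n) := by exact_mod_cast hn₀ n hn
    nlinarith [ha_diam n, ha_pos (n + 1)]
  have hα : Antitone fun j => a (n₀ + j) := antitone_nat_of_succ_le fun j => by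
    have h1 := hhalf (n₀ + j) (by omega)
    have h2 := ha_pos (n₀ + j + 1)
    change a (n₀ + j + 1) ≤ a (n₀ + j)
    linarith
  have hd := completionDist_isMetric (hN := hN) ha_pos ha_lim
  have hf' : ∀ n (g g' : Γ ⧸ N n), ρ₁ (quotientWordDist S (N n) g g') ≤ ‖f ⟨n, g⟩ - f ⟨n, g'⟩‖ ∧
      ‖f ⟨n, g⟩ - f ⟨n, g'⟩‖ ≤ ρ₂ (quotientWordDist S (N n) g g') := fun n g g' => by
    rw [← hD]
    exact hf _ _
  have hdiam : ∀ n (g g' : Γ ⧸ N n),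
      (quotientWordDist S (N n) g g' : ℝ) ≤ quotientWordDiam S (N n) := fun n g g' => by
    exact_mod_cast quotientWordDist_le_diam (N n) g g'
  refine embedsCoarsely_warpedConeDist hd hα (fun j => (ha_pos _).le)
    (by simpa only [add_comm n₀, Function.comp_def] using ha_lim.comp (tendsto_add_atTop_nat n₀))
    (sum_range_le_two_mul_of_halving (fun j => (ha_pos _).le) fun j => hhalf (n₀ + j) (by omega))
    (f := fun j y => f ⟨n₀ + j, y.1 (n₀ + j)⟩)
    (δ := fun j y y' => quotientWordDist S (N (n₀ + j)) (y.1 (n₀ + j)) (y'.1 (n₀ + j)))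
    (L := |ρ₂ 1|) (Δ := quotientWordDiam S (N n₀))
    (fun j y y' h => le_completionDist ha_pos ha_lim fun h' => h (by rw [h'])) (abs_nonneg _)
    (fun s hs j y => ?_) (fun j x y hxy => ?_) (fun j y y' => Nat.cast_nonneg _)
    (fun j y y' => ?_) (fun y y' => hdiam _ _ _) (fun M => ?_)
  · refine ((hf' _ _ _).2.trans (hρ₂ (Set.mem_Ici.2 (Nat.cast_nonneg _))
      (Set.mem_Ici.2 zero_le_one) ?_)).trans (le_abs_self _)
    exact_mod_cast (quotientWordDist_mul_le (N (n₀ + j)) s (y.1 (n₀ + j))).trans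
      (groupWordLength_le_one hs)
  · refine warpedConeDist_le_of_radius_eq ha_pos ha_lim hS (fun m hm => ?_) hxy
    have h1 := hα (show j + 1 ≤ m - n₀ by omega)
    simp only [show n₀ + (m - n₀) = m by omega] at h1
    exact h1
  · exact (mul_le_mul_of_nonneg_left (hdiam _ _ _) (ha_pos _).le).trans (ha_diam (n₀ + j)).le
  -- Divergence of the single function `ρ₁` gives a bound uniform over all levels.
  · obtain ⟨K, hK⟩ := eventually_atTop.1 (hρ₁_lim.eventually_gt_atTop M)
    refine ⟨max K 0, le_max_right _ _, fun j y y' h => ?_⟩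
    by_contra! hlt
    exact absurd ((hK _ ((le_max_left _ _).trans hlt.le)).trans_le (hf' _ _ _).1) (not_lt.2 h)

theorem theoremT {Γ : Type u} [Group Γ]
    (S : Set Γ) (hS_finite : S.Finite) (hS_gen : Subgroup.closure S = ⊤)
    (hΓ : ¬ IsAmenableGroup Γ)
    (N : ℕ → Subgroup Γ) [∀ n, (N n).Normal] [∀ n, (N n).FiniteIndex]
    (hN : Antitone N) (hN_inter : ⨅ n, N n = ⊥)
    (a : ℕ → ℝ) (ha_pos : ∀ n, 0 < a n) (ha_lim : Tendsto a atTop (𝓝 0))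
    (ha_diam : ∀ n, a (n + 1) * (quotientWordDiam S (N n) : ℝ) < a n)
    (ha_two : ∀ g g' : GroupCompletion N hN, completionDist a g g' ≤ 2)
    (D : (Σ n, Γ ⧸ N n) → (Σ n, Γ ⧸ N n) → ℝ)
    (hD : IsCoarseDisjointSum (fun n g g' => (quotientWordDist S (N n) g g' : ℝ)) D)
    (hD_emb : EmbedsCoarselyIntoHilbert D) :
    EmbedsCoarselyIntoHilbert
        (warpedConeDist S (completionDist a : GroupCompletion N hN → GroupCompletion N hN → ℝ)) ∧
      ¬ HasPropertyA
        (warpedConeDist S (completionDist a : GroupCompletion N hN → GroupCompletion N hN → ℝ)) := by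
  exact ⟨embedsCoarsely_warpedConeDist_completion hS_finite hS_gen
      (fun _ => hΓ isAmenableGroup_of_finite) hN_inter ha_pos ha_lim ha_diam hD.restrict hD_emb,
    fun hA => hΓ (isAmenableGroup_of_hasPropertyA hS_finite hS_gen hN_inter ha_pos ha_lim hA)⟩
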